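/- Let $f\colon[-1,1)\to\mathbb{R}$ be absolutely monotonic, i.e. $f$ is $C^\infty$ on $[-1,1)$ (one-sided at $-1$) and $f^{(n)}(t)\ge 0$ for all $n\ge 0$ and all $t\in[-1,1)$. For a finite set $C$ in the unit sphere $S^3\subset\mathbb{R}^4$ let $$E_f(C)=\sum_{c,c'\in C,\ c\ne c'} f(\langle c,c'\rangle).$$ Let $C_{D_4}\subset S^3$ be the set of the $24$ vertices of the regular $24$-cell, i.e. the vectors $(\pm e_i\pm e_j)/\sqrt2$ with $1\le i<j\le 4$. Equip the set of all $24$-element subsets of $S^3$ with the topology given by the Hausdorff distance. (1) $C_{D_4}$ is a local minimum of $E_f$ among $24$-element subsets of $S^3$: there is $\varepsilon>0$ such that $E_f(C_{D_4})\le E_f(C)$ for every $24$-element set $C\subset S^3$ at Hausdorff distance less than $\varepsilon$ from $C_{D_4}$. (2) If $f$ is not (the restriction to $[-1,1)$ of) a polynomial of degree at most $5$, then $C_{D_4}$ is a strict local minimum modulo $\mathrm{O}(4)$: there is $\varepsilon>0$ such that $E_f(C_{D_4})< E_f(C)$ for every $24$-element set $C\subset S^3$ at Hausdorff distance less than $\varepsilon$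 from $C_{D_4}$ that is not of the form $g(C_{D_4})$ with $g\in\mathrm{O}(4)$. -/

import Mathlib

noncomputable section

/-- Euclidean `ℝ⁴`, which contains the unit sphere `S³`. -/
abbrev E4 : Type := EuclideanSpace ℝ (Fin 4)

open scoped Classical in
/-- The energy of a finite code `C`: the sum of `f ⟪c, c'⟫` over all ordered pairs of distinct
points of `C`. -/
def codeEnergy (f : ℝ → ℝ) (C : Finset E4) : ℝ :=
  ∑ p ∈ C.offDiag, f (inner ℝ p.1 p.2)

/-- The roots of `D₄` in the standard coordinates: the integer vectors of norm `√2`,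
that is, the vectors `±eᵢ ± eⱼ` with `i ≠ j`. -/
def rootsD4 : Finset (Fin 4 → ℤ) :=
  (Fintype.piFinset fun _ => Finset.Icc (-1) 1).filter fun v => ∑ i, v i ^ 2 = 2

open scoped Classical in
/-- The vertices of the regular 24-cell in `S³`: the root system of `D₄`, scaled to unit length. -/
def code24Cell : Finset E4 :=
  rootsD4.image fun v => WithLp.toLp 2 fun i => (v i : ℝ) / √2

/-- A configuration of 24 (distinct, unordered) points of `S³`. -/
def IsConfig24 (C : Finset E4) : Prop :=
  (C : Set E4) ⊆ Metric.sphere 0 1 ∧ C.card = 24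

/-- `C₀` is a local minimum of the energy on the space of configurations of 24 points of `S³`,
with the topology given by the Hausdorff distance. -/
def IsLocalMinEnergy (f : ℝ → ℝ) (C₀ : Finset E4) : Prop :=
  ∃ ε > 0, ∀ C : Finset E4, IsConfig24 C →
    Metric.hausdorffDist (C : Set E4) (C₀ : Set E4) < ε → codeEnergy f C₀ ≤ codeEnergy f C

/-- `C₀` is a strict local minimum of the energy modulo the orthogonal group `O(4)`: every
configuration of 24 points close enough to `C₀` has larger energy than `C₀`, unless it is
the image of `C₀` under an orthogonal transformation. -/
def IsStrictLocalMinEnergyModO4 (f : ℝ → ℝ) (C₀ : Finset E4) : Prop :=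
  ∃ ε > 0, ∀ C : Finset E4, IsConfig24 C →
    Metric.hausdorffDist (C : Set E4) (C₀ : Set E4) < ε →
    (¬ ∃ g : E4 ≃ₗᵢ[ℝ] E4, (C : Set E4) = g '' (C₀ : Set E4)) →
    codeEnergy f C₀ < codeEnergy f C

end

/-!
Let `f` be absolutely monotonic on `[-1, 1)`. By Bernstein's theorem (`IsAbsMonoTower.hasSum`) it is
a power series in `1 + t` with nonnegative coefficients, and there are two cases.

If no power beyond the fifth occurs, the 24-cell is a global minimum. It is a spherical 5-design:
for `k ≤ 5` the sum of `(1 + ⟪x, d⟫) ^ k` over its vertices `d` is the same for all unit vectors `x`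
(`sum_one_add_inner_vertex_pow`). As the kernel `(1 + ⟪x, y⟫) ^ k` is positive semidefinite, applying
it to the difference of the counting measures of `C` and of the 24-cell gives the inequality
(`sum_one_add_inner_pow_le`).

Otherwise the 24-cell is a strict local minimum modulo rotations. A configuration close to it is
`{z r}`, where `r` runs through the roots and `z r` is close to the vertex `x_r`. Among its images
under `O(4)`, the one closest to the 24-cell in the sense of least squares has a displacement field
orthogonal to the infinitesimal rotations (`exists_isometry_symm`). If `v` is the tangential part of
the displacement, then, up to errors of third order, the energy grows by a quadratic form in `v`
which involves only `f'` at `-1, ±1/2, 0` and `f''` at `±1/2, 0` (`IsAbsMonoTower.energy_lt_of_near`);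
the first-order terms only contribute to the diagonal of this form, because the weighted sum of the
vertices around a given one is radial.

The quadratic form commutes with the symmetry group of the 24-cell. Its invariant kernels have
eigenspaces of dimensions 4, 6, 8, 8, 9, 9, 12, 16 on the tangent fields, the one of dimension 6
being the infinitesimal rotations, and the eigenvalues of the Hessian are linear functionals of the
seven numbers above. The Hessian is a combination of Gram kernels of tensors such as `v ∧ x` or the
traceless symmetric part of `v ⊗ x ⊗ x`, some of them summed separately over the three orthogonal
frames that make up the 24-cell (`hessKernel_eq`, `sum_psdKernel_nonneg`). The coefficients are the
functionals `eig₄`, …, `eig₉'`, up to positive factors. They are nonnegative on every `(1 + t) ^ n`,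
and those which bound the eigenvalues from below are positive for `n ≥ 6` (`hermiteWeight_bounds`).
This gives a spectral gap (`le_sum_hessKernel`).
-/

noncomputable section

open Set Filter Topology

/-! ### Absolutely monotonic functions and their power series -/

/-- A sequence of nonnegative functions on `[-1, 1)`, each the derivative of the one before it
(one-sided at `-1`): the successive derivatives of an absolutely monotonic function. -/
structure IsAbsMonoTower (F : ℕ → ℝ → ℝ) : Prop where
  hasDeriv : ∀ k, ∀ t ∈ Ico (-1 : ℝ) 1, HasDerivWithinAt (F k) (F (k + 1) t) (Ico (-1) 1) t
  nonneg : ∀ k, ∀ t ∈ Ico (-1 : ℝ) 1, 0 ≤ F k t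

theorem AbsolutelyMonotoneOn.isAbsMonoTower {f : ℝ → ℝ}
    (hf : AbsolutelyMonotoneOn f (Ico (-1) 1)) :
    IsAbsMonoTower fun k => iteratedDerivWithin k f (Ico (-1) 1) where
  hasDeriv k t ht := by
    have h := (hf.contDiffOn.differentiableOn_iteratedDerivWithin (m := k)
      (by exact_mod_cast WithTop.coe_lt_top _) (uniqueDiffOn_Ico _ _)) t ht
    simpa only [iteratedDerivWithin_succ] using h.hasDerivWithinAt
  nonneg k t ht := hf.iteratedDerivWithin_nonneg (uniqueDiffOn_Ico _ _) k ht

theorem monotoneOn_Ico_of_hasDerivWithinAt {a b : ℝ} {g g' : ℝ → ℝ}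
    (hg : ∀ t ∈ Ico a b, HasDerivWithinAt g (g' t) (Ico a b) t)
    (h0 : ∀ t ∈ Ico a b, 0 ≤ g' t) : MonotoneOn g (Ico a b) := by
  have hd : ∀ t ∈ Ioo a b, HasDerivAt g (g' t) t := fun t ht =>
    (hg t (Ioo_subset_Ico_self ht)).hasDerivAt (Ico_mem_nhds ht.1 ht.2)
  refine monotoneOn_of_deriv_nonneg (convex_Ico _ _)
    (fun t ht => (hg t ht).continuousWithinAt) ?_ ?_
  · rw [interior_Ico]
    exact fun t ht => (hd t ht).differentiableAt.differentiableWithinAt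
  · rw [interior_Ico]
    exact fun t ht => (hd t ht).deriv ▸ h0 t (Ioo_subset_Ico_self ht)

/-- A function with nonnegative second derivative lies above its tangent lines. -/
theorem tangent_line_le {a b : ℝ} {g g' g'' : ℝ → ℝ}
    (hg : ∀ t ∈ Ico a b, HasDerivWithinAt g (g' t) (Ico a b) t)
    (hg' : ∀ t ∈ Ico a b, HasDerivWithinAt g' (g'' t) (Ico a b) t)
    (h0 : ∀ t ∈ Ico a b, 0 ≤ g'' t) {t x : ℝ} (ht : t ∈ Ico a b) (hx : x ∈ Ico a b) :
    g t + g' t * (x - t) ≤ g x := by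
  have hm := monotoneOn_Ico_of_hasDerivWithinAt hg' h0
  have key : ∀ u ∈ Ico a b, ∀ v ∈ Ico a b, u < v →
      ∃ c ∈ Ioo u v, g' c = (g v - g u) / (v - u) := fun u hu v hv huv =>
    exists_hasDerivAt_eq_slope g g' huv
      (fun y hy => ((hg y ⟨hu.1.trans hy.1, hy.2.trans_lt hv.2⟩).continuousWithinAt).mono
        fun z hz => ⟨hu.1.trans hz.1, hz.2.trans_lt hv.2⟩)
      (fun y hy => (hg y ⟨hu.1.trans hy.1.le, hy.2.trans hv.2⟩).hasDerivAt
        (Ico_mem_nhds (hu.1.trans_lt hy.1) (hy.2.trans hv.2)))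
  rcases lt_trichotomy t x with h | h | h
  · obtain ⟨c, hc, e⟩ := key t ht x hx h
    have := hm ht ⟨ht.1.trans hc.1.le, hc.2.trans hx.2⟩ hc.1.le
    rw [e, le_div_iff₀ (by linarith)] at this
    linarith
  · simp [h]
  · obtain ⟨c, hc, e⟩ := key x hx t ht h
    have := hm ⟨hx.1.trans hc.1.le, hc.2.trans ht.2⟩ ht hc.2.le
    rw [e, div_le_iff₀ (by linarith)] at this
    linarith

namespace IsAbsMonoTower

variable {F : ℕ → ℝ → ℝ}

theorem succ (hF : IsAbsMonoTower F) : IsAbsMonoTower fun k => F (k + 1) :=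
  ⟨fun k => hF.hasDeriv (k + 1), fun k => hF.nonneg (k + 1)⟩

/-- As the fourth derivative is nonnegative, the function lies above its cubic Taylor
polynomials, on both sides of the base point. -/
theorem cubic_taylor_le (hF : IsAbsMonoTower F) {t x : ℝ} (ht : t ∈ Ico (-1 : ℝ) 1)
    (hx : x ∈ Ico (-1 : ℝ) 1) :
    F 0 t + F 1 t * (x - t) + F 2 t / 2 * (x - t) ^ 2 + F 3 t / 6 * (x - t) ^ 3 ≤ F 0 x := by
  have h2 : ∀ y ∈ Ico (-1 : ℝ) 1, 0 ≤ F 2 y - F 2 t - F 3 t * (y - t) := fun y hy => by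
    have := tangent_line_le (hF.hasDeriv 2) (hF.hasDeriv 3) (hF.nonneg 4) ht hy
    linarith
  have hp : ∀ (n : ℕ) (y : ℝ), HasDerivWithinAt (fun y => (y - t) ^ n)
      (n * (y - t) ^ (n - 1)) (Ico (-1) 1) y := fun n y => by
    simpa using (((hasDerivAt_id y).sub_const t).fun_pow n).hasDerivWithinAt
  have h := tangent_line_le
    (g := fun y => F 0 y - F 1 t * (y - t) ^ 1 - F 2 t / 2 * (y - t) ^ 2 - F 3 t / 6 * (y - t) ^ 3)
    (g' := fun y => F 1 y - F 1 t - F 2 t * (y - t) ^ 1 - F 3 t / 2 * (y - t) ^ 2)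
    (g'' := fun y => F 2 y - F 2 t - F 3 t * (y - t))
    (fun y hy => by
      refine ((((hF.hasDeriv 0 y hy).sub ((hp 1 y).const_mul (F 1 t))).sub
        ((hp 2 y).const_mul (F 2 t / 2))).sub ((hp 3 y).const_mul (F 3 t / 6))).congr_deriv ?_
      simp
      ring)
    (fun y hy => by
      refine ((((hF.hasDeriv 1 y hy).sub_const (F 1 t)).sub
        ((hp 1 y).const_mul (F 2 t))).sub ((hp 2 y).const_mul (F 3 t / 2))).congr_deriv ?_
      simp
      ring) h2 ht hx
  simp only [sub_self, pow_one, mul_zero, ne_eq, OfNat.ofNat_ne_zero, not_false_eq_true, zero_pow,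
    sub_zero, zero_mul, add_zero] at h
  linarith

/-- The remainder of the Taylor polynomial with `n` terms at `-1`. -/
def taylorRem (F : ℕ → ℝ → ℝ) (n : ℕ) (t : ℝ) : ℝ :=
  F 0 t - ∑ k ∈ Finset.range n, F k (-1) / k.factorial * (t + 1) ^ k

theorem taylorRem_hasDeriv (hF : IsAbsMonoTower F) (n : ℕ) {t : ℝ} (ht : t ∈ Ico (-1 : ℝ) 1) :
    HasDerivWithinAt (taylorRem F (n + 1)) (taylorRem (fun k => F (k + 1)) n t)
      (Ico (-1) 1) t := by
  unfold taylorRem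
  refine (hF.hasDeriv 0 t ht).sub ?_
  simp_rw [Finset.sum_range_succ' _ n]
  simp only [pow_zero, Nat.factorial_zero, Nat.cast_one, div_one, mul_one]
  refine (HasDerivWithinAt.fun_sum fun k _ => ?_).add_const _
  have h := (((((hasDerivAt_id t).add_const 1).pow (k + 1)).const_mul
    (F (k + 1) (-1) / (k + 1).factorial))).hasDerivWithinAt (s := Ico (-1 : ℝ) 1)
  refine h.congr_deriv ?_
  have : (k.factorial : ℝ) ≠ 0 := by positivity
  simp [Nat.factorial_succ]
  field_simp

theorem taylorRem_neg_one (n : ℕ) : taylorRem F (n + 1) (-1) = 0 := by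
  simp [taylorRem, Finset.sum_range_succ']

theorem taylorRem_nonneg (hF : IsAbsMonoTower F) (n : ℕ) {t : ℝ} (ht : t ∈ Ico (-1 : ℝ) 1) :
    0 ≤ taylorRem F n t := by
  induction n generalizing F t with
  | zero => simpa [taylorRem] using hF.nonneg 0 t ht
  | succ n ih =>
    have := monotoneOn_Ico_of_hasDerivWithinAt (fun t ht => hF.taylorRem_hasDeriv n ht)
      (fun t ht => ih hF.succ ht) (by norm_num) ht ht.1
    rwa [taylorRem_neg_one] at this

/-- Bernstein's estimate: `taylorRem F n t / (t + 1) ^ n` is nondecreasing in `t`. -/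
theorem taylorRem_scale (hF : IsAbsMonoTower F) (n : ℕ) {θ t : ℝ} (h0 : 0 ≤ θ) (h1 : θ ≤ 1)
    (ht : t ∈ Ico (-1 : ℝ) 1) :
    taylorRem F n (-1 + θ * (t + 1)) ≤ θ ^ n * taylorRem F n t := by
  have hmaps : MapsTo (fun t : ℝ => -1 + θ * (t + 1)) (Ico (-1) 1) (Ico (-1) 1) := by
    intro t ht
    have := ht.1
    have := ht.2
    constructor <;> dsimp only <;> nlinarith
  induction n generalizing F t with
  | zero =>
    have hm := monotoneOn_Ico_of_hasDerivWithinAt (hF.hasDeriv 0) (hF.nonneg 1)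
    simpa [taylorRem] using hm (hmaps ht) ht (by nlinarith [ht.1])
  | succ n ih =>
    have hlin : ∀ t : ℝ, HasDerivWithinAt (fun t : ℝ => -1 + θ * (t + 1)) θ (Ico (-1) 1) t :=
      fun t => by
        simpa using ((((hasDerivAt_id t).add_const 1).const_mul θ).const_add (-1)).hasDerivWithinAt
    have := monotoneOn_Ico_of_hasDerivWithinAt
      (g := fun t => θ ^ (n + 1) * taylorRem F (n + 1) t - taylorRem F (n + 1) (-1 + θ * (t + 1)))
      (g' := fun t => θ ^ (n + 1) * taylorRem (fun k => F (k + 1)) n t -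
        taylorRem (fun k => F (k + 1)) n (-1 + θ * (t + 1)) * θ)
      (fun t ht => ((hF.taylorRem_hasDeriv n ht).const_mul _).sub
        (HasDerivWithinAt.comp (h₂ := taylorRem F (n + 1)) t
          (hF.taylorRem_hasDeriv n (hmaps ht)) (hlin t) hmaps))
      (fun t ht => by
        have := mul_le_mul_of_nonneg_right (ih hF.succ ht) h0
        rw [pow_succ]
        linarith) (show (-1 : ℝ) ∈ Ico (-1) 1 by norm_num) ht ht.1
    simp only [taylorRem_neg_one, neg_add_cancel, mul_zero, add_zero, sub_zero] at this
    linarith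

/-- Bernstein's theorem: an absolutely monotonic function on `[-1, 1)` is the sum of its Taylor
series at `-1`. -/
theorem hasSum (hF : IsAbsMonoTower F) {t : ℝ} (ht : t ∈ Ico (-1 : ℝ) 1) :
    HasSum (fun k => F k (-1) / k.factorial * (t + 1) ^ k) (F 0 t) := by
  have hm1 : (-1 : ℝ) ∈ Ico (-1 : ℝ) 1 := by norm_num
  rw [hasSum_iff_tendsto_nat_of_nonneg fun k =>
    mul_nonneg (div_nonneg (hF.nonneg k _ hm1) (by positivity)) (pow_nonneg (by linarith [ht.1]) _)]
  -- `t` lies a factor `θ < 1` closer to `-1` than the point `b ∈ (t, 1)`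
  set b := (t + 1) / 2 with hb
  have hbm : b ∈ Ico (-1 : ℝ) 1 := ⟨by linarith [ht.1], by linarith [ht.2]⟩
  have hb0 : 0 < b + 1 := by linarith [ht.1]
  set θ := (t + 1) / (b + 1) with hθ
  have hθ0 : 0 ≤ θ := div_nonneg (by linarith [ht.1]) hb0.le
  have hθ1 : θ < 1 := (div_lt_one hb0).2 (by linarith [ht.2])
  have ht' : -1 + θ * (b + 1) = t := by
    rw [hθ, div_mul_cancel₀ _ hb0.ne']
    ring
  have hlim : Tendsto (fun n => taylorRem F n t) atTop (𝓝 0) := by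
    refine squeeze_zero (g := fun n => θ ^ n * F 0 b) (fun n => hF.taylorRem_nonneg n ht)
      (fun n => ?_) ?_
    · have h := hF.taylorRem_scale n hθ0 hθ1.le hbm
      rw [ht'] at h
      refine h.trans (mul_le_mul_of_nonneg_left ?_ (pow_nonneg hθ0 _))
      refine sub_le_self _ (Finset.sum_nonneg fun k _ => ?_)
      exact mul_nonneg (div_nonneg (hF.nonneg k _ hm1) (by positivity)) (pow_nonneg hb0.le _)
    · simpa using (tendsto_pow_atTop_nhds_zero_of_lt_one hθ0 hθ1).mul_const (F 0 b)
  have := (tendsto_const_nhds (x := F 0 t)).sub hlim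
  simpa [taylorRem] using this

end IsAbsMonoTower

/-! ### The spectrum of the Hessian: positivity of its eigenvalues -/

/-- A linear functional in the values of `f'` at `-1, -1/2, 0, 1/2` and of `f''` at
`-1/2, 0, 1/2`, where the functions `f'` and `f''` are given as `p` and `q`. -/
def hermiteFunctional (a₀ a₁ a₂ a₃ b₁ b₂ b₃ : ℝ) (p q : ℝ → ℝ) : ℝ :=
  a₀ * p (-1) + a₁ * p (-1 / 2) + a₂ * p 0 + a₃ * p (1 / 2) +
    (b₁ * q (-1 / 2) + b₂ * q 0 + b₃ * q (1 / 2))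

/-- The value of `hermiteFunctional` at `f' = (1 + t) ^ m`, multiplied by `2 ^ m`. -/
def hermiteWeight (a₀ a₁ a₂ a₃ b₁ b₂ b₃ : ℝ) (m : ℕ) : ℝ :=
  a₀ * 0 ^ m + a₁ + a₂ * 2 ^ m + a₃ * 3 ^ m +
    m * (2 * b₁ + b₂ * 2 ^ m + 2 / 3 * b₃ * 3 ^ m)

namespace IsAbsMonoTower

variable {F : ℕ → ℝ → ℝ}

/-- The power series of the second derivative, as the termwise derivative of that of the first. -/
theorem hasSum_deriv_two (hF : IsAbsMonoTower F) {t : ℝ} (ht : t ∈ Ico (-1 : ℝ) 1) :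
    HasSum (fun m : ℕ => F (m + 1) (-1) / m.factorial * (m * (t + 1) ^ (m - 1))) (F 2 t) := by
  rw [← hasSum_nat_add_iff' 1]
  simp only [Finset.sum_range_one, Nat.cast_zero, zero_mul, mul_zero, sub_zero]
  refine hF.succ.succ.hasSum ht |>.congr_fun fun m => ?_
  have : (m.factorial : ℝ) ≠ 0 := by positivity
  have : (m : ℝ) + 1 ≠ 0 := by positivity
  simp [Nat.factorial_succ]
  field_simp

theorem hasSum_hermiteFunctional (hF : IsAbsMonoTower F) (a₀ a₁ a₂ a₃ b₁ b₂ b₃ : ℝ) :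
    HasSum (fun m : ℕ => F (m + 1) (-1) / m.factorial *
      (hermiteWeight a₀ a₁ a₂ a₃ b₁ b₂ b₃ m / 2 ^ m))
      (hermiteFunctional a₀ a₁ a₂ a₃ b₁ b₂ b₃ (F 1) (F 2)) := by
  have h1 : ∀ t ∈ Ico (-1 : ℝ) 1, _ := fun t ht => hF.succ.hasSum ht
  have h2 : ∀ t ∈ Ico (-1 : ℝ) 1, _ := fun t ht => hF.hasSum_deriv_two ht
  have e0 : (-1 : ℝ) ∈ Ico (-1 : ℝ) 1 := by norm_num
  have e1 : (-1 / 2 : ℝ) ∈ Ico (-1 : ℝ) 1 := by norm_num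
  have e2 : (0 : ℝ) ∈ Ico (-1 : ℝ) 1 := by norm_num
  have e3 : (1 / 2 : ℝ) ∈ Ico (-1 : ℝ) 1 := by norm_num
  refine (((((h1 _ e0).mul_left a₀).add ((h1 _ e1).mul_left a₁)).add
    ((h1 _ e2).mul_left a₂)).add ((h1 _ e3).mul_left a₃)).add
    ((((h2 _ e1).mul_left b₁).add ((h2 _ e2).mul_left b₂)).add ((h2 _ e3).mul_left b₃))
    |>.congr_fun fun m => ?_
  have p2 : (2 : ℝ) ^ m ≠ 0 := by positivity
  rcases m with _ | m
  · simp [hermiteWeight]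
    ring
  · have p3 : (2 : ℝ) ^ (m + 1) ≠ 0 := by positivity
    have q1 : (-1 / 2 + 1 : ℝ) = 1 / 2 := by norm_num
    have q3 : (1 / 2 + 1 : ℝ) = 3 / 2 := by norm_num
    simp only [hermiteWeight, q1, q3, div_pow, one_pow, zero_add, neg_add_cancel,
      ne_eq, Nat.add_eq_zero_iff, one_ne_zero, and_false, not_false_eq_true, zero_pow,
      Nat.add_sub_cancel]
    rw [pow_succ (2 : ℝ), pow_succ (3 : ℝ)]
    have p4 : (2 : ℝ) ^ m ≠ 0 := by positivity
    field_simp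
    ring

theorem coeff_nonneg (hF : IsAbsMonoTower F) (m : ℕ) : 0 ≤ F (m + 1) (-1) / m.factorial :=
  div_nonneg (hF.nonneg _ _ (by norm_num)) (by positivity)

theorem hermiteFunctional_nonneg (hF : IsAbsMonoTower F) {a₀ a₁ a₂ a₃ b₁ b₂ b₃ : ℝ}
    (h : ∀ m, 0 ≤ hermiteWeight a₀ a₁ a₂ a₃ b₁ b₂ b₃ m) :
    0 ≤ hermiteFunctional a₀ a₁ a₂ a₃ b₁ b₂ b₃ (F 1) (F 2) :=
  (hF.hasSum_hermiteFunctional a₀ a₁ a₂ a₃ b₁ b₂ b₃).nonneg fun m =>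
    mul_nonneg (hF.coeff_nonneg m) (div_nonneg (h m) (by positivity))

theorem hermiteFunctional_pos (hF : IsAbsMonoTower F) {a₀ a₁ a₂ a₃ b₁ b₂ b₃ : ℝ}
    (h : ∀ m, 0 ≤ hermiteWeight a₀ a₁ a₂ a₃ b₁ b₂ b₃ m)
    (h' : ∀ m, 5 ≤ m → 0 < hermiteWeight a₀ a₁ a₂ a₃ b₁ b₂ b₃ m)
    {m : ℕ} (hm : 5 ≤ m) (hFm : F (m + 1) (-1) ≠ 0) :
    0 < hermiteFunctional a₀ a₁ a₂ a₃ b₁ b₂ b₃ (F 1) (F 2) := by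
  have hs := hF.hasSum_hermiteFunctional a₀ a₁ a₂ a₃ b₁ b₂ b₃
  refine lt_of_lt_of_le ?_ (le_hasSum hs m fun k _ =>
    mul_nonneg (hF.coeff_nonneg k) (div_nonneg (h k) (by positivity)))
  have : 0 < F (m + 1) (-1) := lt_of_le_of_ne (hF.nonneg _ _ (by norm_num)) hFm.symm
  have := h' m hm
  positivity

/-- If all derivatives of order at least six vanish at `-1`, the function is a polynomial of
degree at most five. -/
theorem eq_sum_of_deriv_eq_zero (hF : IsAbsMonoTower F)
    (h : ∀ m, 5 ≤ m → F (m + 1) (-1) = 0) {t : ℝ} (ht : t ∈ Ico (-1 : ℝ) 1) :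
    F 0 t = ∑ k ∈ Finset.range 6, F k (-1) / k.factorial * (t + 1) ^ k := by
  refine (hF.hasSum ht).unique (hasSum_sum_of_ne_finset_zero fun k hk => ?_)
  obtain ⟨m, rfl⟩ : ∃ m, k = m + 1 := ⟨k - 1, by simp at hk; omega⟩
  rw [h m (by simp at hk; omega)]
  simp

end IsAbsMonoTower

/-- The eigenvalue of the Hessian with eigenspace of dimension 4. -/
def eig₄ : (ℝ → ℝ) → (ℝ → ℝ) → ℝ := hermiteFunctional 2 10 4 2 3 2 1

/-- The eigenvalue of the Hessian with eigenspace of dimension 16. -/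
def eig₁₆ : (ℝ → ℝ) → (ℝ → ℝ) → ℝ := hermiteFunctional 2 4 (-2) (-4) 3 2 1

/-- The eigenvalue of the Hessian on one of the two eigenspaces of dimension 8. -/
def eig₈ : (ℝ → ℝ) → (ℝ → ℝ) → ℝ := hermiteFunctional 2 4 (-2) (-4) 0 2 4

/-- The eigenvalue of the Hessian on the other eigenspace of dimension 8, minus a quarter of
`eig₈`. The kernel `symm₃`, which is used for the first one, has its eigenvalues there in the
ratio 4 : 1. -/
def eig₈' : (ℝ → ℝ) → (ℝ → ℝ) → ℝ :=
  hermiteFunctional (3 / 2) 0 (9 / 2) (-6) (3 / 2) (3 / 2) (3 / 2)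

/-- The eigenvalue of the Hessian with eigenspace of dimension 12. -/
def eig₁₂ : (ℝ → ℝ) → (ℝ → ℝ) → ℝ := hermiteFunctional 0 6 0 (-6) 3 0 3

/-- The smaller of the two eigenvalues of the Hessian with eigenspaces of dimension 9. -/
def eig₉ : (ℝ → ℝ) → (ℝ → ℝ) → ℝ := hermiteFunctional 0 6 0 (-6) 1 4 1

/-- The difference of the eigenvalues of the Hessian on the two eigenspaces of dimension 9. -/
def eig₉' : (ℝ → ℝ) → (ℝ → ℝ) → ℝ := hermiteFunctional 0 (-4) 0 4 2 0 2

set_option maxHeartbeats 1000000 in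
/-- Positivity of the functionals `eig₄`, …, `eig₉'` on the powers of `1 + t`. From `m = 10` on the
terms in `m * 3 ^ m` and `m * 2 ^ m` dominate. -/
theorem hermiteWeight_bounds (m : ℕ) :
    (0 ≤ hermiteWeight 2 10 4 2 3 2 1 m ∧ 0 ≤ hermiteWeight 2 4 (-2) (-4) 3 2 1 m ∧
      0 ≤ hermiteWeight 2 4 (-2) (-4) 0 2 4 m ∧
      0 ≤ hermiteWeight (3 / 2) 0 (9 / 2) (-6) (3 / 2) (3 / 2) (3 / 2) m ∧
      0 ≤ hermiteWeight 0 6 0 (-6) 3 0 3 m ∧ 0 ≤ hermiteWeight 0 6 0 (-6) 1 4 1 m ∧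
      0 ≤ hermiteWeight 0 (-4) 0 4 2 0 2 m) ∧
    (5 ≤ m → 0 < hermiteWeight 2 10 4 2 3 2 1 m ∧ 0 < hermiteWeight 2 4 (-2) (-4) 3 2 1 m ∧
      0 < hermiteWeight 2 4 (-2) (-4) 0 2 4 m ∧
      0 < hermiteWeight (3 / 2) 0 (9 / 2) (-6) (3 / 2) (3 / 2) (3 / 2) m ∧
      0 < hermiteWeight 0 6 0 (-6) 3 0 3 m ∧ 0 < hermiteWeight 0 6 0 (-6) 1 4 1 m) := by
  rcases lt_or_ge m 10 with hm | hm
  · interval_cases m <;> norm_num [hermiteWeight]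
  · have h0 : (0 : ℝ) ^ m = 0 := zero_pow (by omega)
    have hm' : (10 : ℝ) ≤ m := by exact_mod_cast hm
    have h2 : (0 : ℝ) < 2 ^ m := by positivity
    have h3 : (0 : ℝ) < 3 ^ m := by positivity
    have k2 := mul_le_mul_of_nonneg_right hm' h2.le
    have k3 := mul_le_mul_of_nonneg_right hm' h3.le
    simp only [hermiteWeight, h0]
    refine ⟨⟨?_, ?_, ?_, ?_, ?_, ?_, ?_⟩, fun _ => ⟨?_, ?_, ?_, ?_, ?_, ?_⟩⟩ <;> linarith

/-! ### The roots of `D₄` -/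

/-- The vertex of the 24-cell in the direction of an integer vector of norm `√2`. -/
def vertex (r : Fin 4 → ℤ) : E4 := WithLp.toLp 2 fun i => (r i : ℝ) / √2

/-- The indicator functions of the three orthogonal frames, each closed under negation, which
partition the roots: the roots whose support is `{0, i}` or its complement, for `i = 1, 2, 3`. -/
def frameInd (G : Fin 3) (r : Fin 4 → ℤ) : ℤ :=
  ![r 0 ^ 2 * r 1 ^ 2 + r 2 ^ 2 * r 3 ^ 2, r 0 ^ 2 * r 2 ^ 2 + r 1 ^ 2 * r 3 ^ 2,
    r 0 ^ 2 * r 3 ^ 2 + r 1 ^ 2 * r 2 ^ 2] G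

/-- Two roots belong to the same frame if and only if they are equal, opposite or orthogonal. -/
theorem rootsD4_dotProduct_cases : ∀ r ∈ rootsD4, ∀ s ∈ rootsD4,
    (r ⬝ᵥ s = 2 ∧ r = s ∧ ∑ G, frameInd G r * frameInd G s = 1) ∨
    (r ⬝ᵥ s = 1 ∧ r ≠ s ∧ ∑ G, frameInd G r * frameInd G s = 0) ∨
    (r ⬝ᵥ s = 0 ∧ r ≠ s ∧ ∑ G, frameInd G r * frameInd G s = 1) ∨
    (r ⬝ᵥ s = -1 ∧ r ≠ s ∧ ∑ G, frameInd G r * frameInd G s = 0) ∨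
    (r ⬝ᵥ s = -2 ∧ s = -r ∧ r ≠ s ∧ ∑ G, frameInd G r * frameInd G s = 1) := by
  decide +kernel

theorem sum_frameInd : ∀ r ∈ rootsD4, ∑ G, frameInd G r = 1 := by decide +kernel

theorem vertex_inner (r s : Fin 4 → ℤ) : inner ℝ (vertex r) (vertex s) = ((r ⬝ᵥ s : ℤ) : ℝ) / 2 := by
  have h : √2 * √2 = (2 : ℝ) := Real.mul_self_sqrt (by norm_num)
  simp only [vertex, PiLp.inner_apply, RCLike.inner_apply, conj_trivial, div_mul_div_comm, h,
    dotProduct, Int.cast_sum, Int.cast_mul, Finset.sum_div]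
  exact Finset.sum_congr rfl fun i _ => by rw [mul_comm]

theorem vertex_neg (r : Fin 4 → ℤ) : vertex (-r) = -vertex r := by
  ext i
  simp [vertex, neg_div]

theorem vertex_injective : Function.Injective vertex := fun r s h => by
  funext i
  have := congrArg (fun x : E4 => x i) h
  simpa [vertex, div_left_inj'] using this

theorem norm_vertex {r : Fin 4 → ℤ} (hr : r ∈ rootsD4) : ‖vertex r‖ = 1 := by
  have h := vertex_inner r r
  rw [real_inner_self_eq_norm_sq] at h
  rcases rootsD4_dotProduct_cases r hr r hr with h' | h' | h' | h' | h'
  · rw [h'.1] at h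
    norm_num at h
    exact h.resolve_right fun h => by linarith [norm_nonneg (vertex r)]
  all_goals simp at h'

/-! ### Positive semidefinite kernels on tangent fields -/

/-- A kernel which is a positive multiple of a product of two Gram kernels is positive
semidefinite. -/
theorem sum_sum_nonneg_of_gram {ι κ μ : Type*} [Fintype κ] [Fintype μ] {S : Finset ι}
    (g : κ → ι → ℝ) (c : μ → ι → ℝ) {K : ι → ι → ℝ} {m : ℝ} (hm : 0 < m)
    (h : ∀ r ∈ S, ∀ s ∈ S, (∑ i, g i r * g i s) * ∑ j, c j r * c j s = m * K r s) :
    0 ≤ ∑ r ∈ S, ∑ s ∈ S, K r s := by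
  have e : m * ∑ r ∈ S, ∑ s ∈ S, K r s = ∑ p : κ × μ, (∑ r ∈ S, g p.1 r * c p.2 r) ^ 2 := by
    calc
      _ = ∑ r ∈ S, ∑ s ∈ S, (∑ i, g i r * g i s) * ∑ j, c j r * c j s := by
        simp_rw [Finset.mul_sum]
        exact Finset.sum_congr rfl fun r hr => Finset.sum_congr rfl fun s hs => by
          rw [← h r hr s hs, Finset.mul_sum]
      _ = _ := by
        simp_rw [sq, Finset.sum_mul_sum, ← Finset.univ_product_univ, Finset.sum_product]
        simp_rw [Finset.sum_comm (s := S) (t := Finset.univ)]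
        exact Finset.sum_congr rfl fun i _ => Finset.sum_congr rfl fun j _ =>
          Finset.sum_congr rfl fun r _ => Finset.sum_congr rfl fun s _ => by ring
  refine nonneg_of_mul_nonneg_right ?_ hm
  rw [e]
  positivity

theorem inner_eq_sum_four (x y : E4) :
    inner ℝ x y = x 0 * y 0 + x 1 * y 1 + x 2 * y 2 + x 3 * y 3 := by
  simp only [PiLp.inner_apply, RCLike.inner_apply, conj_trivial, Fin.sum_univ_four]
  ring

/-- The components of `v ∧ x`. -/
def wedge (v x : E4) (i : Fin 4 × Fin 4) : ℝ := v i.1 * x i.2 - x i.1 * v i.2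

/-- The components of the symmetric product of `v` and `x`. -/
def symm₂ (v x : E4) (i : Fin 4 × Fin 4) : ℝ := v i.1 * x i.2 + x i.1 * v i.2

/-- The components of the traceless part of `(v ∧ x) ⊗ x`, for a unit vector `x` and `v`
orthogonal to `x`. -/
def mixed₃ (v x : E4) (i : Fin 4 × Fin 4 × Fin 4) : ℝ :=
  wedge v x (i.1, i.2.1) * x i.2.2 -
    1 / 3 * (v i.1 * (if i.2.1 = i.2.2 then 1 else 0) - v i.2.1 * (if i.1 = i.2.2 then 1 else 0))

/-- The components of the traceless part of the symmetric product of `v`, `x` and `x`, for a unit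
vector `x` and `v` orthogonal to `x`. -/
def symm₃ (v x : E4) (i : Fin 4 × Fin 4 × Fin 4) : ℝ :=
  v i.1 * x i.2.1 * x i.2.2 + x i.1 * v i.2.1 * x i.2.2 + x i.1 * x i.2.1 * v i.2.2 -
    1 / 6 * (v i.1 * (if i.2.1 = i.2.2 then 1 else 0) + v i.2.1 * (if i.1 = i.2.2 then 1 else 0) +
      v i.2.2 * (if i.1 = i.2.1 then 1 else 0))

theorem sum_wedge (v x w y : E4) :
    ∑ i, wedge v x i * wedge w y i =
      2 * (inner ℝ x y * inner ℝ v w - inner ℝ v y * inner ℝ x w) := by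
  simp only [Fintype.sum_prod_type, Fin.sum_univ_four, wedge, inner_eq_sum_four]
  ring

theorem sum_symm₂ (v x w y : E4) :
    ∑ i, symm₂ v x i * symm₂ w y i =
      2 * (inner ℝ x y * inner ℝ v w + inner ℝ v y * inner ℝ x w) := by
  simp only [Fintype.sum_prod_type, Fin.sum_univ_four, symm₂, inner_eq_sum_four]
  ring

set_option maxHeartbeats 4000000 in
theorem sum_mixed₃ {v x w y : E4} (hx : inner ℝ x x = (1 : ℝ)) (hy : inner ℝ y y = (1 : ℝ))
    (hv : inner ℝ v x = (0 : ℝ)) (hw : inner ℝ w y = (0 : ℝ)) :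
    ∑ i, mixed₃ v x i * mixed₃ w y i =
      2 * ((inner ℝ x y ^ 2 - 1 / 3) * inner ℝ v w - inner ℝ x y * (inner ℝ v y * inner ℝ x w)) := by
  have key : ∑ i, mixed₃ v x i * mixed₃ w y i =
      2 * inner ℝ x y * (inner ℝ x y * inner ℝ v w - inner ℝ v y * inner ℝ x w)
      - 2 / 3 * (inner ℝ v w * inner ℝ x x - inner ℝ v x * inner ℝ x w)
      - 2 / 3 * (inner ℝ v w * inner ℝ y y - inner ℝ w y * inner ℝ v y)
      + 2 / 3 * inner ℝ v w := by
    simp only [Fintype.sum_prod_type, Fin.sum_univ_four, mixed₃, wedge, inner_eq_sum_four]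
    simp
    ring
  rw [key, hx, hy, hv, hw]
  ring

set_option maxHeartbeats 4000000 in
theorem sum_symm₃ {v x w y : E4} (hx : inner ℝ x x = (1 : ℝ)) (hy : inner ℝ y y = (1 : ℝ))
    (hv : inner ℝ v x = (0 : ℝ)) (hw : inner ℝ w y = (0 : ℝ)) :
    ∑ i, symm₃ v x i * symm₃ w y i =
      3 * ((inner ℝ x y ^ 2 - 1 / 6) * inner ℝ v w +
        2 * inner ℝ x y * (inner ℝ v y * inner ℝ x w)) := by
  have key : ∑ i, symm₃ v x i * symm₃ w y i =
      3 * inner ℝ x y ^ 2 * inner ℝ v w + 6 * inner ℝ x y * (inner ℝ v y * inner ℝ x w)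
      - 1 / 2 * (inner ℝ x x * inner ℝ v w + 2 * inner ℝ v x * inner ℝ x w)
      - 1 / 2 * (inner ℝ y y * inner ℝ v w + 2 * inner ℝ w y * inner ℝ v y)
      + 1 / 2 * inner ℝ v w := by
    simp only [Fintype.sum_prod_type, Fin.sum_univ_four, symm₃, inner_eq_sum_four]
    simp
    ring
  rw [key, hx, hy, hv, hw]
  ring

/-! ### The Hessian of the energy at the 24-cell -/

/-- The kernel of the quadratic form `∑ r, ∑ s, hessKernel p q v r s`, which is the second-order
term of the energy at the 24-cell in the direction of a tangent field `v`, where `p = f'` and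
`q = f''`. -/
def hessKernel (p q : ℝ → ℝ) (v : (Fin 4 → ℤ) → E4) (r s : Fin 4 → ℤ) : ℝ :=
  if r = s then
    (p (-1) + 4 * p (-1 / 2) - 4 * p (1 / 2) + 2 * (q (-1 / 2) + q 0 + q (1 / 2))) * ‖v r‖ ^ 2
  else p (inner ℝ (vertex r) (vertex s)) * inner ℝ (v r) (v s) +
    q (inner ℝ (vertex r) (vertex s)) * (inner ℝ (v r) (vertex s) * inner ℝ (vertex r) (v s))

/-- The kernel of the frame indicator functions. -/
def frameKernel (r s : Fin 4 → ℤ) : ℝ := ∑ G, (frameInd G r : ℝ) * frameInd G s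

/-- A combination of eight kernels on tangent fields. The first seven are positive semidefinite,
each being the Gram kernel of a family of tensors. The last one is the square of the orthogonal
projection to the infinitesimal rotations, up to a factor. -/
def psdKernel (c₁ c₂ c₃ c₄ c₅ c₆ c₇ c₈ : ℝ) (v : (Fin 4 → ℤ) → E4) (r s : Fin 4 → ℤ) : ℝ :=
  let t : ℝ := inner ℝ (vertex r) (vertex s)
  let a : ℝ := inner ℝ (v r) (v s)
  let b : ℝ := inner ℝ (v r) (vertex s) * inner ℝ (vertex r) (v s)
  c₁ * a + c₂ * ((3 * frameKernel r s - 1) * a) +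
    c₃ * ((t ^ 2 - 1 / 3) * a - t * b) + c₄ * ((t ^ 2 - 1 / 6) * a + 2 * t * b) +
    c₅ * ((3 * frameKernel r s - 1) * (t * a - b)) + c₆ * (frameKernel r s * (t * a + b)) +
    c₇ * (t * a + b) + c₈ * (t * a - b)

/-- The Hessian as a combination of kernels which are visibly positive semidefinite. The
coefficients result from comparing the eigenvalues on the common eigenspaces; the identity is
checked for each of the five possible inner products. -/
theorem hessKernel_eq (p q : ℝ → ℝ) {v : (Fin 4 → ℤ) → E4} {r s : Fin 4 → ℤ}
    (ht : ∀ r ∈ rootsD4, inner ℝ (v r) (vertex r) = (0 : ℝ))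
    (hr : r ∈ rootsD4) (hs : s ∈ rootsD4) :
    hessKernel p q v r s =
      psdKernel (eig₄ p q / 18) (eig₈' p q / 18) (eig₁₆ p q / 3) (eig₈ p q / 6) (eig₁₂ p q / 12)
        (eig₉ p q / 4) (eig₉' p q / 8)
        (-eig₁₆ p q / 6 + eig₈ p q / 6 + eig₁₂ p q / 12 + eig₉' p q / 8 - q (1 / 2)) v r s := by
  have hf : frameKernel r s = ((∑ G, frameInd G r * frameInd G s : ℤ) : ℝ) := by
    simp [frameKernel]
  have ht' : inner ℝ (vertex s) (v s) = (0 : ℝ) := by rw [real_inner_comm, ht s hs]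
  rcases rootsD4_dotProduct_cases r hr s hs with h | h | h | h | h
  · obtain ⟨h1, rfl, h3⟩ := h
    rw [hessKernel, if_pos rfl, psdKernel, hf, vertex_inner, h1, h3, ← real_inner_self_eq_norm_sq, ht r hr]
    simp only [eig₄, eig₁₆, eig₈, eig₈', eig₁₂, eig₉, eig₉', hermiteFunctional]
    push_cast
    ring
  · obtain ⟨h1, h2, h3⟩ := h
    rw [hessKernel, if_neg h2, psdKernel, hf, vertex_inner, h1, h3]
    simp only [eig₄, eig₁₆, eig₈, eig₈', eig₁₂, eig₉, eig₉', hermiteFunctional]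
    push_cast
    ring
  · obtain ⟨h1, h2, h3⟩ := h
    rw [hessKernel, if_neg h2, psdKernel, hf, vertex_inner, h1, h3]
    simp only [eig₄, eig₁₆, eig₈, eig₈', eig₁₂, eig₉, eig₉', hermiteFunctional, Int.cast_zero,
      zero_div]
    push_cast
    ring
  · obtain ⟨h1, h2, h3⟩ := h
    rw [hessKernel, if_neg h2, psdKernel, hf, vertex_inner, h1, h3]
    simp only [eig₄, eig₁₆, eig₈, eig₈', eig₁₂, eig₉, eig₉', hermiteFunctional, Int.reduceNeg,
      Int.cast_neg, Int.cast_one]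
    push_cast
    ring
  · obtain ⟨h1, rfl, h2, h3⟩ := h
    have hv : inner ℝ (v r) (vertex (-r)) = (0 : ℝ) := by
      rw [vertex_neg, inner_neg_right, ht r hr, neg_zero]
    rw [hessKernel, if_neg h2, psdKernel, hf, vertex_inner, h1, h3, hv]
    simp only [eig₄, eig₁₆, eig₈, eig₈', eig₁₂, eig₉, eig₉', hermiteFunctional]
    have e : (((-2 : ℤ) : ℝ) / 2) = -1 := by norm_num
    rw [e]
    push_cast
    ring

/-- The decomposition of the identity which corresponds to `hessKernel_eq` with all eigenvalues
equal to one. -/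
theorem ite_norm_sq_eq {v : (Fin 4 → ℤ) → E4} {r s : Fin 4 → ℤ}
    (ht : ∀ r ∈ rootsD4, inner ℝ (v r) (vertex r) = (0 : ℝ))
    (hr : r ∈ rootsD4) (hs : s ∈ rootsD4) :
    (if r = s then ‖v r‖ ^ 2 else 0) =
      psdKernel (1 / 18) (1 / 24) (1 / 3) (1 / 6) (1 / 12) (1 / 4) 0 (1 / 12) v r s := by
  have hf : frameKernel r s = ((∑ G, frameInd G r * frameInd G s : ℤ) : ℝ) := by
    simp [frameKernel]
  rcases rootsD4_dotProduct_cases r hr s hs with h | h | h | h | h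
  · obtain ⟨h1, rfl, h3⟩ := h
    rw [if_pos rfl, psdKernel, hf, vertex_inner, h1, h3, ← real_inner_self_eq_norm_sq, ht r hr]
    push_cast
    ring
  · obtain ⟨h1, h2, h3⟩ := h
    rw [if_neg h2, psdKernel, hf, vertex_inner, h1, h3]
    push_cast
    ring
  · obtain ⟨h1, h2, h3⟩ := h
    rw [if_neg h2, psdKernel, hf, vertex_inner, h1, h3]
    push_cast
    ring
  · obtain ⟨h1, h2, h3⟩ := h
    rw [if_neg h2, psdKernel, hf, vertex_inner, h1, h3]
    push_cast
    ring
  · obtain ⟨h1, rfl, h2, h3⟩ := h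
    have hv : inner ℝ (v r) (vertex (-r)) = (0 : ℝ) := by
      rw [vertex_neg, inner_neg_right, ht r hr, neg_zero]
    rw [if_neg h2, psdKernel, hf, vertex_inner, h1, h3, hv]
    push_cast
    ring

theorem inner_vertex_self {r : Fin 4 → ℤ} (hr : r ∈ rootsD4) :
    inner ℝ (vertex r) (vertex r) = (1 : ℝ) := by
  rw [real_inner_self_eq_norm_sq, norm_vertex hr, one_pow]

/-- The Gram kernel of the frame indicator functions, with their mean removed. -/
theorem sum_frameInd_sub_mul {r s : Fin 4 → ℤ} (hr : r ∈ rootsD4) (hs : s ∈ rootsD4) :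
    ∑ G, (3 * (frameInd G r : ℝ) - 1) * (3 * (frameInd G s : ℝ) - 1) =
      3 * (3 * frameKernel r s - 1) := by
  have h1 : (∑ G, (frameInd G r : ℝ)) = 1 := by exact_mod_cast sum_frameInd r hr
  have h2 : (∑ G, (frameInd G s : ℝ)) = 1 := by exact_mod_cast sum_frameInd s hs
  simp only [frameKernel, Fin.sum_univ_three] at *
  linear_combination (-3) * h1 - 3 * h2

/-- The first seven kernels are Gram kernels of tensors; the coefficient of the last one does not
matter for fields orthogonal to the infinitesimal rotations. -/
theorem sum_psdKernel_nonneg {c₁ c₂ c₃ c₄ c₅ c₆ c₇ c₈ : ℝ} {v : (Fin 4 → ℤ) → E4}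
    (ht : ∀ r ∈ rootsD4, inner ℝ (v r) (vertex r) = (0 : ℝ))
    (hrot : ∀ a b, ∑ r ∈ rootsD4, v r a * vertex r b = ∑ r ∈ rootsD4, v r b * vertex r a)
    (h₁ : 0 ≤ c₁) (h₂ : 0 ≤ c₂) (h₃ : 0 ≤ c₃) (h₄ : 0 ≤ c₄) (h₅ : 0 ≤ c₅) (h₆ : 0 ≤ c₆)
    (h₇ : 0 ≤ c₇) :
    0 ≤ ∑ r ∈ rootsD4, ∑ s ∈ rootsD4, psdKernel c₁ c₂ c₃ c₄ c₅ c₆ c₇ c₈ v r s := by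
  have hin : ∀ x y : E4, ∑ i, x i * y i = inner ℝ x y := fun x y => by
    simp [PiLp.inner_apply, mul_comm]
  have hmid : ∀ r s, frameKernel r s = ∑ G, (frameInd G r : ℝ) * frameInd G s := fun _ _ => rfl
  have hone : ∑ _i : Unit, (1 : ℝ) * 1 = 1 := by simp
  have k₁ : 0 ≤ ∑ r ∈ rootsD4, ∑ s ∈ rootsD4, (inner ℝ (v r) (v s) : ℝ) :=
    sum_sum_nonneg_of_gram (fun (_ : Unit) _ => 1) (fun i r => v r i) one_pos
      fun r _ s _ => by rw [hone, hin]
  have k₂ : 0 ≤ ∑ r ∈ rootsD4, ∑ s ∈ rootsD4,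
      (3 * frameKernel r s - 1) * (inner ℝ (v r) (v s) : ℝ) :=
    sum_sum_nonneg_of_gram (fun G r => 3 * (frameInd G r : ℝ) - 1) (fun i r => v r i) three_pos
      fun r hr s hs => by rw [sum_frameInd_sub_mul hr hs, hin, mul_assoc]
  have k₃ := sum_sum_nonneg_of_gram (S := rootsD4) (fun (_ : Unit) _ => 1)
    (fun i r => mixed₃ (v r) (vertex r) i) two_pos fun r hr s hs => by
      rw [hone, sum_mixed₃ (inner_vertex_self hr) (inner_vertex_self hs) (ht r hr) (ht s hs),
        one_mul]
  have k₄ := sum_sum_nonneg_of_gram (S := rootsD4) (fun (_ : Unit) _ => 1)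
    (fun i r => symm₃ (v r) (vertex r) i) three_pos fun r hr s hs => by
      rw [hone, sum_symm₃ (inner_vertex_self hr) (inner_vertex_self hs) (ht r hr) (ht s hs),
        one_mul]
  have k₅ := sum_sum_nonneg_of_gram (S := rootsD4) (fun G r => 3 * (frameInd G r : ℝ) - 1)
    (fun i r => wedge (v r) (vertex r) i) (m := 6) (by norm_num) fun r hr s hs => by
      rw [sum_frameInd_sub_mul hr hs, sum_wedge, mul_mul_mul_comm]
      norm_num only
      rfl
  have k₆ := sum_sum_nonneg_of_gram (S := rootsD4) (fun G r => (frameInd G r : ℝ))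
    (fun i r => symm₂ (v r) (vertex r) i) two_pos fun r hr s hs => by
      rw [← hmid, sum_symm₂, mul_left_comm]
  have k₇ := sum_sum_nonneg_of_gram (S := rootsD4) (fun (_ : Unit) _ => 1)
    (fun i r => symm₂ (v r) (vertex r) i) two_pos fun r hr s hs => by
      rw [hone, sum_symm₂, one_mul]
  have k₈ : 2 * ∑ r ∈ rootsD4, ∑ s ∈ rootsD4, (inner ℝ (vertex r) (vertex s) * inner ℝ (v r) (v s) -
      inner ℝ (v r) (vertex s) * inner ℝ (vertex r) (v s) : ℝ) = 0 := by
    have h0 : ∑ i, (∑ r ∈ rootsD4, wedge (v r) (vertex r) i) ^ 2 = 0 :=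
      Finset.sum_eq_zero fun i _ => by
        simp only [wedge, Finset.sum_sub_distrib, mul_comm (vertex _ _)]
        rw [hrot i.1 i.2, sub_self, sq, zero_mul]
    rw [← h0]
    simp_rw [sq, Finset.sum_mul_sum, Finset.mul_sum, ← sum_wedge]
    simp_rw [Finset.sum_comm (s := rootsD4) (t := Finset.univ)]
  have hadd : ∀ {K K' : (Fin 4 → ℤ) → (Fin 4 → ℤ) → ℝ},
      0 ≤ ∑ r ∈ rootsD4, ∑ s ∈ rootsD4, K r s → 0 ≤ ∑ r ∈ rootsD4, ∑ s ∈ rootsD4, K' r s →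
      0 ≤ ∑ r ∈ rootsD4, ∑ s ∈ rootsD4, (K r s + K' r s) := fun h h' => by
    simpa only [Finset.sum_add_distrib] using add_nonneg h h'
  have hmul : ∀ {K : (Fin 4 → ℤ) → (Fin 4 → ℤ) → ℝ} {c : ℝ}, 0 ≤ c →
      0 ≤ ∑ r ∈ rootsD4, ∑ s ∈ rootsD4, K r s →
      0 ≤ ∑ r ∈ rootsD4, ∑ s ∈ rootsD4, c * K r s := fun hc h => by
    simpa only [← Finset.mul_sum] using mul_nonneg hc h
  refine hadd (hadd (hadd (hadd (hadd (hadd (hadd (hmul h₁ k₁) (hmul h₂ k₂)) (hmul h₃ k₃))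
    (hmul h₄ k₄)) (hmul h₅ k₅)) (hmul h₆ k₆)) (hmul h₇ k₇)) ?_
  simp only [← Finset.mul_sum]
  rw [(mul_eq_zero.1 k₈).resolve_left two_ne_zero, mul_zero]

/-- On the tangent fields orthogonal to the infinitesimal rotations, the Hessian is bounded below
by the least of its other eigenvalues. -/
theorem le_sum_hessKernel {p q : ℝ → ℝ} {ε : ℝ} {v : (Fin 4 → ℤ) → E4}
    (ht : ∀ r ∈ rootsD4, inner ℝ (v r) (vertex r) = (0 : ℝ))
    (hrot : ∀ a b, ∑ r ∈ rootsD4, v r a * vertex r b = ∑ r ∈ rootsD4, v r b * vertex r a)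
    (h4 : ε ≤ eig₄ p q) (h16 : ε ≤ eig₁₆ p q) (h8 : ε ≤ eig₈ p q)
    (h8' : ε ≤ eig₈' p q) (h12 : ε ≤ eig₁₂ p q) (h9 : ε ≤ eig₉ p q) (h9' : 0 ≤ eig₉' p q)
    (hε : 0 ≤ ε) :
    ε * ∑ r ∈ rootsD4, ‖v r‖ ^ 2 ≤ ∑ r ∈ rootsD4, ∑ s ∈ rootsD4, hessKernel p q v r s := by
  have hdiag : ε * ∑ r ∈ rootsD4, ‖v r‖ ^ 2 =
      ∑ r ∈ rootsD4, ∑ s ∈ rootsD4, ε * (if r = s then ‖v r‖ ^ 2 else 0) := by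
    rw [Finset.mul_sum]
    refine Finset.sum_congr rfl fun r hr => ?_
    rw [← Finset.mul_sum, Finset.sum_ite_eq, if_pos hr]
  rw [hdiag, ← sub_nonneg]
  simp only [← Finset.sum_sub_distrib]
  have hnn := sum_psdKernel_nonneg (c₁ := (eig₄ p q - ε) / 18) (c₂ := (eig₈' p q - 3 / 4 * ε) / 18)
    (c₃ := (eig₁₆ p q - ε) / 3) (c₄ := (eig₈ p q - ε) / 6) (c₅ := (eig₁₂ p q - ε) / 12)
    (c₆ := (eig₉ p q - ε) / 4) (c₇ := eig₉' p q / 8)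
    (c₈ := -eig₁₆ p q / 6 + eig₈ p q / 6 + eig₁₂ p q / 12 + eig₉' p q / 8 - q (1 / 2) - ε / 12)
    ht hrot (by linarith) (by linarith) (by linarith) (by linarith) (by linarith) (by linarith)
    (by linarith)
  refine hnn.trans_eq (Finset.sum_congr rfl fun r hr => Finset.sum_congr rfl fun s hs => ?_)
  rw [hessKernel_eq p q ht hr hs, ite_norm_sq_eq ht hr hs]
  simp only [psdKernel]
  ring

/-! ### Sums over the shells of the 24-cell -/

theorem shell_sum : ∀ r ∈ rootsD4, ∀ a,
    (∑ s ∈ rootsD4 with r ⬝ᵥ s = 1, s a = 4 * r a) ∧ (∑ s ∈ rootsD4 with r ⬝ᵥ s = 0, s a = 0) ∧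
    (∑ s ∈ rootsD4 with r ⬝ᵥ s = -1, s a = -4 * r a) ∧
    (∑ s ∈ rootsD4 with r ⬝ᵥ s = -2, s a = -r a) := by
  decide +kernel

theorem shell_sum_mul : ∀ r ∈ rootsD4, ∀ a b,
    (∑ s ∈ rootsD4 with r ⬝ᵥ s = 1, s a * s b = if a = b then 4 else 0) ∧
    (∑ s ∈ rootsD4 with r ⬝ᵥ s = 0, s a * s b = (if a = b then 4 else 0) - 2 * r a * r b) ∧
    (∑ s ∈ rootsD4 with r ⬝ᵥ s = -1, s a * s b = if a = b then 4 else 0) ∧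
    (∑ s ∈ rootsD4 with r ⬝ᵥ s = -2, s a * s b = r a * r b) := by
  decide +kernel

/-- Splitting a sum over the other vertices into the four shells around a vertex. -/
theorem sum_ite_eq_sum_shells (p : ℝ → ℝ) (g : (Fin 4 → ℤ) → ℝ) {r : Fin 4 → ℤ}
    (hr : r ∈ rootsD4) :
    ∑ s ∈ rootsD4, (if r = s then 0 else p (inner ℝ (vertex r) (vertex s)) * g s) =
      p (-1) * ∑ s ∈ rootsD4 with r ⬝ᵥ s = -2, g s +
      p (-1 / 2) * ∑ s ∈ rootsD4 with r ⬝ᵥ s = -1, g s +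
      p 0 * ∑ s ∈ rootsD4 with r ⬝ᵥ s = 0, g s +
      p (1 / 2) * ∑ s ∈ rootsD4 with r ⬝ᵥ s = 1, g s := by
  simp only [Finset.sum_filter, Finset.mul_sum, ← Finset.sum_add_distrib]
  refine Finset.sum_congr rfl fun s hs => ?_
  rcases rootsD4_dotProduct_cases r hr s hs with ⟨h1, h2, -⟩ | ⟨h1, h2, -⟩ | ⟨h1, h2, -⟩ |
    ⟨h1, h2, -⟩ | ⟨h1, -, h2, -⟩
  · subst h2
    simp [h1]
  all_goals
    simp only [h2, vertex_inner, h1, if_false]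
    norm_num

theorem inner_vertex (u : E4) (s : Fin 4 → ℤ) :
    inner ℝ u (vertex s) = ∑ a, u a / √2 * (s a : ℝ) := by
  simp only [vertex, PiLp.inner_apply, RCLike.inner_apply, conj_trivial]
  exact Finset.sum_congr rfl fun a _ => by ring

/-- The radial sum of the derivatives `p = f'` over the vertices other than a given one. -/
def radialSum (p : ℝ → ℝ) : ℝ := -p (-1) - 4 * p (-1 / 2) + 4 * p (1 / 2)

theorem sum_mul_inner_vertex (p : ℝ → ℝ) (u : E4) {r : Fin 4 → ℤ} (hr : r ∈ rootsD4) :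
    ∑ s ∈ rootsD4, (if r = s then 0 else
      p (inner ℝ (vertex r) (vertex s)) * inner ℝ u (vertex s)) =
      radialSum p * inner ℝ u (vertex r) := by
  have key : ∀ (k c : ℤ), (∀ a, ∑ s ∈ rootsD4 with r ⬝ᵥ s = k, s a = c * r a) →
      ∑ s ∈ rootsD4 with r ⬝ᵥ s = k, (inner ℝ u (vertex s) : ℝ) = c * inner ℝ u (vertex r) := by
    intro k c h
    simp_rw [inner_vertex]
    rw [Finset.sum_comm, Finset.mul_sum]
    refine Finset.sum_congr rfl fun a _ => ?_
    rw [← Finset.mul_sum, ← Int.cast_sum, h]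
    push_cast
    ring
  rw [sum_ite_eq_sum_shells p (fun s => inner ℝ u (vertex s)) hr,
    key 1 4 fun a => (shell_sum r hr a).1, key 0 0 fun a => by simp [(shell_sum r hr a).2.1],
    key (-1) (-4) fun a => (shell_sum r hr a).2.2.1,
    key (-2) (-1) fun a => by simp [(shell_sum r hr a).2.2.2], radialSum]
  push_cast
  ring

theorem sum_mul_inner_vertex_sq (q : ℝ → ℝ) {u : E4} {r : Fin 4 → ℤ} (hr : r ∈ rootsD4)
    (hu : inner ℝ u (vertex r) = (0 : ℝ)) :
    ∑ s ∈ rootsD4, (if r = s then 0 else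
      q (inner ℝ (vertex r) (vertex s)) * inner ℝ u (vertex s) ^ 2) =
      2 * (q (-1 / 2) + q 0 + q (1 / 2)) * ‖u‖ ^ 2 := by
  have h2 : √2 * √2 = (2 : ℝ) := Real.mul_self_sqrt (by norm_num)
  have key : ∀ (k c d : ℤ), (∀ a b, ∑ s ∈ rootsD4 with r ⬝ᵥ s = k, s a * s b =
      (if a = b then c else 0) + d * (r a * r b)) →
      ∑ s ∈ rootsD4 with r ⬝ᵥ s = k, (inner ℝ u (vertex s) : ℝ) ^ 2 = c / 2 * ‖u‖ ^ 2 := by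
    intro k c d h
    have hsq : ∀ s : Fin 4 → ℤ, (inner ℝ u (vertex s) : ℝ) ^ 2 =
        ∑ a, ∑ b, u a * u b / 2 * ((s a * s b : ℤ) : ℝ) := fun s => by
      rw [inner_vertex, sq, Finset.sum_mul_sum]
      refine Finset.sum_congr rfl fun a _ => Finset.sum_congr rfl fun b _ => ?_
      rw [mul_mul_mul_comm, div_mul_div_comm, h2]
      push_cast
      ring
    have hnorm : ‖u‖ ^ 2 = ∑ a, u a * u a := by
      rw [EuclideanSpace.real_norm_sq_eq]
      exact Finset.sum_congr rfl fun a _ => sq _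
    have hr0 := hsq r
    rw [hu] at hr0
    calc ∑ s ∈ rootsD4 with r ⬝ᵥ s = k, (inner ℝ u (vertex s) : ℝ) ^ 2
        = ∑ a, ∑ b, u a * u b / 2 * ((∑ s ∈ rootsD4 with r ⬝ᵥ s = k, s a * s b : ℤ) : ℝ) := by
          simp_rw [hsq, Int.cast_sum, Finset.mul_sum]
          rw [Finset.sum_comm]
          exact Finset.sum_congr rfl fun a _ => Finset.sum_comm
      _ = ∑ a, ∑ b, ((if a = b then c * (u a * u a) / 2 else 0) +
            d * (u a * u b / 2 * ((r a * r b : ℤ) : ℝ))) := by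
          refine Finset.sum_congr rfl fun a _ => Finset.sum_congr rfl fun b _ => ?_
          rw [h]
          split_ifs with hab
          · subst hab
            push_cast
            ring
          · push_cast
            ring
      _ = c / 2 * ‖u‖ ^ 2 := by
          simp only [Finset.sum_add_distrib, ← Finset.mul_sum]
          rw [← hr0, hnorm]
          simp only [Finset.sum_ite_eq, Finset.mem_univ, if_true, Finset.mul_sum]
          norm_num
          exact Finset.sum_congr rfl fun a _ => by ring
  rw [sum_ite_eq_sum_shells q (fun s => inner ℝ u (vertex s) ^ 2) hr,
    key 1 4 0 fun a b => by simp [(shell_sum_mul r hr a b).1],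
    key 0 4 (-2) fun a b => by rw [(shell_sum_mul r hr a b).2.1]; ring,
    key (-1) 4 0 fun a b => by simp [(shell_sum_mul r hr a b).2.2.1],
    key (-2) 0 1 fun a b => by simp [(shell_sum_mul r hr a b).2.2.2]]
  push_cast
  ring

/-! ### Local growth of the energy -/

/-- The component of `z - x` tangent to the unit sphere at `x`, for unit vectors `x` and `z`. -/
def tangentPart (x z : E4) : E4 := (z - x) + (‖z - x‖ ^ 2 / 2) • x

theorem inner_sub_self_of_norm_eq_one {x z : E4} (hx : ‖x‖ = 1) (hz : ‖z‖ = 1) :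
    inner ℝ (z - x) x = -(‖z - x‖ ^ 2 / 2) := by
  rw [norm_sub_sq_real, hx, hz, inner_sub_left, real_inner_self_eq_norm_sq, hx]
  ring

theorem inner_tangentPart {x z : E4} (hx : ‖x‖ = 1) (hz : ‖z‖ = 1) :
    inner ℝ (tangentPart x z) x = (0 : ℝ) := by
  rw [tangentPart, inner_add_left, inner_sub_self_of_norm_eq_one hx hz, real_inner_smul_left,
    real_inner_self_eq_norm_sq, hx]
  ring

theorem norm_tangentPart_sq {x z : E4} (hx : ‖x‖ = 1) (hz : ‖z‖ = 1) :
    ‖tangentPart x z‖ ^ 2 = ‖z - x‖ ^ 2 - ‖z - x‖ ^ 4 / 4 := by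
  rw [tangentPart, norm_add_sq_real, real_inner_smul_right, inner_sub_self_of_norm_eq_one hx hz,
    norm_smul, hx, mul_one, Real.norm_eq_abs, sq_abs]
  ring

theorem norm_tangentPart_le {x z : E4} (hx : ‖x‖ = 1) (hz : ‖z‖ = 1) :
    ‖tangentPart x z‖ ≤ ‖z - x‖ := by
  refine le_of_sq_le_sq ?_ (norm_nonneg _)
  rw [norm_tangentPart_sq hx hz]
  have : 0 ≤ ‖z - x‖ ^ 4 := by positivity
  linarith

/-- The change of the inner product of two unit vectors under a perturbation of size at most `ρ`,
up to errors of third order. -/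
theorem inner_perturbation {x y z w : E4} {ρ : ℝ} (hx : ‖x‖ = 1) (hy : ‖y‖ = 1) (hz : ‖z‖ = 1)
    (hw : ‖w‖ = 1) (hzx : ‖z - x‖ ≤ ρ) (hwy : ‖w - y‖ ≤ ρ) (hρ : ρ ≤ 1) :
    |inner ℝ z w - inner ℝ x y - (inner ℝ (z - x) y + inner ℝ x (w - y)) -
      inner ℝ (tangentPart x z) (tangentPart y w)| ≤ ρ * (‖z - x‖ ^ 2 + ‖w - y‖ ^ 2) ∧
    (inner ℝ (tangentPart x z) y + inner ℝ x (tangentPart y w)) ^ 2 -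
      4 * ρ * (‖z - x‖ ^ 2 + ‖w - y‖ ^ 2) ≤ (inner ℝ z w - inner ℝ x y) ^ 2 ∧
    |inner ℝ z w - inner ℝ x y| ^ 3 ≤ 32 * ρ * (‖z - x‖ ^ 2 + ‖w - y‖ ^ 2) := by
  set v := tangentPart x z with hv
  set u := tangentPart y w with hu
  set n := ‖z - x‖
  set k := ‖w - y‖
  have hn : 0 ≤ n := norm_nonneg _
  have hk : 0 ≤ k := norm_nonneg _
  have ha : |inner ℝ x u| ≤ k := by
    refine (abs_real_inner_le_norm x u).trans ?_
    rw [hx, one_mul]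
    exact norm_tangentPart_le hy hw
  have hb : |inner ℝ v y| ≤ n := by
    refine (abs_real_inner_le_norm v y).trans ?_
    rw [hy, mul_one]
    exact norm_tangentPart_le hx hz
  have ht : |inner ℝ x y| ≤ 1 := by simpa [hx, hy] using abs_real_inner_le_norm x y
  have hd : |inner ℝ (z - x) (w - y)| ≤ n * k := abs_real_inner_le_norm _ _
  have ezx : z - x = v - (n ^ 2 / 2) • x := by rw [hv, tangentPart, add_sub_cancel_right]
  have ewy : w - y = u - (k ^ 2 / 2) • y := by rw [hu, tangentPart, add_sub_cancel_right]
  have hl : inner ℝ z w - inner ℝ x y =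
      inner ℝ (z - x) y + inner ℝ x (w - y) + inner ℝ (z - x) (w - y) := by
    simp only [inner_sub_left, inner_sub_right]
    ring
  have hl1 : (inner ℝ (z - x) y : ℝ) = inner ℝ v y - n ^ 2 / 2 * inner ℝ x y := by
    rw [ezx, inner_sub_left, real_inner_smul_left]
  have hl2 : (inner ℝ x (w - y) : ℝ) = inner ℝ x u - k ^ 2 / 2 * inner ℝ x y := by
    rw [ewy, inner_sub_right, real_inner_smul_right]
  have he : (inner ℝ (z - x) (w - y) : ℝ) = inner ℝ v u - n ^ 2 / 2 * inner ℝ x u -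
      k ^ 2 / 2 * inner ℝ v y + n ^ 2 / 2 * (k ^ 2 / 2) * inner ℝ x y := by
    rw [ezx, ewy]
    simp only [inner_sub_left, inner_sub_right, real_inner_smul_left, real_inner_smul_right]
    ring
  generalize (inner ℝ (z - x) (w - y) : ℝ) = e at *
  generalize (inner ℝ (z - x) y : ℝ) = l₁ at *
  generalize (inner ℝ x (w - y) : ℝ) = l₂ at *
  generalize (inner ℝ z w - inner ℝ x y : ℝ) = σ at *
  generalize (inner ℝ x y : ℝ) = t at *
  generalize (inner ℝ x u : ℝ) = a at *
  generalize (inner ℝ v y : ℝ) = b at *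
  generalize (inner ℝ v u : ℝ) = d at *
  clear_value n k
  rw [abs_le] at ha hb ht hd
  have hρ0 : 0 ≤ ρ := hn.trans hzx
  have hnk : n * k ≤ (n ^ 2 + k ^ 2) / 2 := by linarith [sq_nonneg (n - k), sub_sq n k]
  have hσ : |σ - (b + a)| ≤ n ^ 2 + k ^ 2 := by
    have e2 : σ - (b + a) = -((n ^ 2 + k ^ 2) / 2 * t) + e := by
      rw [hl, hl1, hl2]
      ring
    have b1 : |(n ^ 2 + k ^ 2) / 2 * t| ≤ (n ^ 2 + k ^ 2) / 2 * 1 := by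
      rw [abs_mul, abs_of_nonneg (by positivity)]
      exact mul_le_mul_of_nonneg_left (abs_le.2 ht) (by positivity)
    rw [abs_le] at b1
    rw [e2, abs_le]
    constructor <;> linarith
  have hL : |b + a| ≤ n + k := abs_le.2 ⟨by linarith, by linarith⟩
  refine ⟨?_, ?_, ?_⟩
  · have e1 : σ - (l₁ + l₂) - d = -(n ^ 2 / 2 * a) - k ^ 2 / 2 * b + n ^ 2 / 2 * (k ^ 2 / 2) * t := by
      rw [hl, he]
      ring
    have b1 : |n ^ 2 / 2 * a| ≤ n ^ 2 / 2 * ρ := by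
      rw [abs_mul, abs_of_nonneg (by positivity)]
      exact mul_le_mul_of_nonneg_left ((abs_le.2 ha).trans hwy) (by positivity)
    have b2 : |k ^ 2 / 2 * b| ≤ k ^ 2 / 2 * ρ := by
      rw [abs_mul, abs_of_nonneg (by positivity)]
      exact mul_le_mul_of_nonneg_left ((abs_le.2 hb).trans hzx) (by positivity)
    have b3 : |n ^ 2 / 2 * (k ^ 2 / 2) * t| ≤ n ^ 2 / 2 * (ρ / 2) := by
      rw [abs_mul, abs_of_nonneg (by positivity), mul_assoc]
      refine mul_le_mul_of_nonneg_left ?_ (by positivity)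
      have : k ^ 2 ≤ ρ := (pow_le_of_le_one hk (hwy.trans hρ) two_ne_zero).trans hwy
      calc k ^ 2 / 2 * |t| ≤ k ^ 2 / 2 * 1 :=
            mul_le_mul_of_nonneg_left (abs_le.2 ht) (by positivity)
        _ ≤ ρ / 2 := by linarith
    rw [abs_le] at b1 b2 b3
    have : 0 ≤ k ^ 2 * ρ := by positivity
    have : 0 ≤ n ^ 2 * ρ := by positivity
    rw [e1, abs_le]
    constructor <;> linarith
  · have h2 : |b + a| * |σ - (b + a)| ≤ 2 * ρ * (n ^ 2 + k ^ 2) :=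
      mul_le_mul (hL.trans (by linarith)) hσ (abs_nonneg _) (by linarith)
    rw [← abs_mul, abs_le] at h2
    have e3 : σ ^ 2 = (b + a) ^ 2 + 2 * ((b + a) * (σ - (b + a))) + (σ - (b + a)) ^ 2 := by ring
    linarith [sq_nonneg (σ - (b + a))]
  · have h3 : |σ| ≤ 2 * (n + k) := by
      have : |σ| ≤ |σ - (b + a)| + |b + a| := by
        simpa using abs_add_le (σ - (b + a)) (b + a)
      have : n ^ 2 ≤ n := pow_le_of_le_one hn (hzx.trans hρ) two_ne_zero
      have : k ^ 2 ≤ k := pow_le_of_le_one hk (hwy.trans hρ) two_ne_zero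
      linarith
    have h4 : |σ| ≤ 4 * ρ := by linarith
    have h5 : |σ| ^ 2 ≤ 8 * (n ^ 2 + k ^ 2) := by
      have := pow_le_pow_left₀ (abs_nonneg σ) h3 2
      linarith [sq_nonneg (n - k), show (2 * (n + k)) ^ 2 =
        8 * (n ^ 2 + k ^ 2) - 4 * (n - k) ^ 2 by ring]
    calc |σ| ^ 3 = |σ| * |σ| ^ 2 := by ring
      _ ≤ 4 * ρ * (8 * (n ^ 2 + k ^ 2)) := mul_le_mul h4 h5 (by positivity) (by linarith)
      _ = _ := by ring

/-- The pairwise form of the second-order expansion of the energy. -/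
theorem IsAbsMonoTower.second_order_le {F : ℕ → ℝ → ℝ} (hF : IsAbsMonoTower F) {x y z w : E4}
    {ρ A : ℝ} (hx : ‖x‖ = 1) (hy : ‖y‖ = 1) (hz : ‖z‖ = 1) (hw : ‖w‖ = 1)
    (hzx : ‖z - x‖ ≤ ρ) (hwy : ‖w - y‖ ≤ ρ) (hρ : ρ ≤ 1)
    (hxy : inner ℝ x y ∈ Ico (-1 : ℝ) 1) (hzw : inner ℝ z w ∈ Ico (-1 : ℝ) 1)
    (hA₁ : F 1 (inner ℝ x y) ≤ A) (hA₂ : F 2 (inner ℝ x y) ≤ A) (hA₃ : F 3 (inner ℝ x y) ≤ A) :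
    F 0 (inner ℝ x y) + F 1 (inner ℝ x y) * (inner ℝ (z - x) y + inner ℝ x (w - y)) +
      (F 1 (inner ℝ x y) * inner ℝ (tangentPart x z) (tangentPart y w) + F 2 (inner ℝ x y) / 2 *
        (inner ℝ (tangentPart x z) y + inner ℝ x (tangentPart y w)) ^ 2) -
      9 * A * ρ * (‖z - x‖ ^ 2 + ‖w - y‖ ^ 2) ≤ F 0 (inner ℝ z w) := by
  obtain ⟨h1, h2, h3⟩ := inner_perturbation hx hy hz hw hzx hwy hρ
  have h := hF.cubic_taylor_le hxy hzw
  have p1 := hF.nonneg 1 _ hxy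
  have p2 := hF.nonneg 2 _ hxy
  have p3 := hF.nonneg 3 _ hxy
  have hρ0 : 0 ≤ ρ := (norm_nonneg _).trans hzx
  have hM : 0 ≤ ρ * (‖z - x‖ ^ 2 + ‖w - y‖ ^ 2) := by positivity
  generalize ‖z - x‖ ^ 2 + ‖w - y‖ ^ 2 = M at *
  have k1 := mul_le_mul_of_nonneg_left (abs_le.1 h1).1 p1
  have k2 := mul_le_mul_of_nonneg_left h2 p2
  have k3 := mul_le_mul_of_nonneg_left h3 p3
  have k4 : -(F 3 (inner ℝ x y) * |inner ℝ z w - inner ℝ x y| ^ 3) ≤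
      F 3 (inner ℝ x y) * (inner ℝ z w - inner ℝ x y) ^ 3 := by
    rw [← abs_pow, ← mul_neg]
    exact mul_le_mul_of_nonneg_left (neg_abs_le _) p3
  have m1 := mul_le_mul_of_nonneg_right hA₁ hM
  have m2 := mul_le_mul_of_nonneg_right hA₂ hM
  have m3 := mul_le_mul_of_nonneg_right hA₃ hM
  have m4 : 0 ≤ A * (ρ * M) := mul_nonneg (p1.trans hA₁) hM
  linarith

/-- The second-order part of the energy in terms of the Hessian. The squares of the inner products
of `v r` with the vertices around `vertex r` add up to a multiple of `‖v r‖ ^ 2`. The term in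
`radialSum` comes from the first-order part: it compensates for the curvature of the sphere. -/
theorem sum_offDiag_second_order (p q : ℝ → ℝ) {v : (Fin 4 → ℤ) → E4}
    (ht : ∀ r ∈ rootsD4, inner ℝ (v r) (vertex r) = (0 : ℝ)) :
    ∑ r ∈ rootsD4, ∑ s ∈ rootsD4, (if r = s then 0 else
      p (inner ℝ (vertex r) (vertex s)) * inner ℝ (v r) (v s) +
        q (inner ℝ (vertex r) (vertex s)) / 2 *
          (inner ℝ (v r) (vertex s) + inner ℝ (vertex r) (v s)) ^ 2) =
      ∑ r ∈ rootsD4, ∑ s ∈ rootsD4, hessKernel p q v r s +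
        radialSum p * ∑ r ∈ rootsD4, ‖v r‖ ^ 2 := by
  have h1 : ∑ r ∈ rootsD4, ∑ s ∈ rootsD4, (if r = s then 0 else
      q (inner ℝ (vertex r) (vertex s)) * inner ℝ (v r) (vertex s) ^ 2) =
      2 * (q (-1 / 2) + q 0 + q (1 / 2)) * ∑ r ∈ rootsD4, ‖v r‖ ^ 2 := by
    rw [Finset.mul_sum]
    exact Finset.sum_congr rfl fun r hr => sum_mul_inner_vertex_sq q hr (ht r hr)
  have h2 : ∑ r ∈ rootsD4, ∑ s ∈ rootsD4, (if r = s then 0 else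
      q (inner ℝ (vertex r) (vertex s)) * inner ℝ (vertex r) (v s) ^ 2) =
      2 * (q (-1 / 2) + q 0 + q (1 / 2)) * ∑ r ∈ rootsD4, ‖v r‖ ^ 2 := by
    rw [Finset.sum_comm, ← h1]
    refine Finset.sum_congr rfl fun r _ => Finset.sum_congr rfl fun s _ => ?_
    rw [real_inner_comm (vertex r) (vertex s), real_inner_comm (v r) (vertex s)]
    simp only [eq_comm]
  have h3 : ∑ r ∈ rootsD4, (2 * (q (-1 / 2) + q 0 + q (1 / 2)) - radialSum p) * ‖v r‖ ^ 2 =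
      ∑ r ∈ rootsD4, ∑ s ∈ rootsD4, (if r = s then
        (2 * (q (-1 / 2) + q 0 + q (1 / 2)) - radialSum p) * ‖v r‖ ^ 2 else 0) :=
    Finset.sum_congr rfl fun r hr => by rw [Finset.sum_ite_eq, if_pos hr]
  have h4 : ∑ r ∈ rootsD4, ∑ s ∈ rootsD4, hessKernel p q v r s +
      ((∑ r ∈ rootsD4, ∑ s ∈ rootsD4, (if r = s then 0 else
        q (inner ℝ (vertex r) (vertex s)) * inner ℝ (v r) (vertex s) ^ 2)) / 2 +
      (∑ r ∈ rootsD4, ∑ s ∈ rootsD4, (if r = s then 0 else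
        q (inner ℝ (vertex r) (vertex s)) * inner ℝ (vertex r) (v s) ^ 2)) / 2) =
      ∑ r ∈ rootsD4, ∑ s ∈ rootsD4, (if r = s then 0 else
      p (inner ℝ (vertex r) (vertex s)) * inner ℝ (v r) (v s) +
        q (inner ℝ (vertex r) (vertex s)) / 2 *
          (inner ℝ (v r) (vertex s) + inner ℝ (vertex r) (v s)) ^ 2) +
      ∑ r ∈ rootsD4, (2 * (q (-1 / 2) + q 0 + q (1 / 2)) - radialSum p) * ‖v r‖ ^ 2 := by
    rw [h3]
    simp only [Finset.sum_div, ← Finset.sum_add_distrib]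
    refine Finset.sum_congr rfl fun r _ => Finset.sum_congr rfl fun s _ => ?_
    rw [hessKernel, radialSum]
    split_ifs <;> ring
  rw [h1, h2, ← Finset.mul_sum] at h4
  linarith

/-- The first-order part of the energy only depends on the radial components of the
displacement, which are of second order. -/
theorem sum_offDiag_first_order (p : ℝ → ℝ) (w : (Fin 4 → ℤ) → E4) :
    ∑ r ∈ rootsD4, ∑ s ∈ rootsD4, (if r = s then 0 else
      p (inner ℝ (vertex r) (vertex s)) *
        (inner ℝ (w r) (vertex s) + inner ℝ (vertex r) (w s))) =
      2 * radialSum p * ∑ r ∈ rootsD4, inner ℝ (w r) (vertex r) := by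
  have h1 : ∑ r ∈ rootsD4, ∑ s ∈ rootsD4, (if r = s then 0 else
      p (inner ℝ (vertex r) (vertex s)) * inner ℝ (w r) (vertex s)) =
      radialSum p * ∑ r ∈ rootsD4, inner ℝ (w r) (vertex r) := by
    rw [Finset.mul_sum]
    exact Finset.sum_congr rfl fun r hr => sum_mul_inner_vertex p (w r) hr
  have h2 : ∑ r ∈ rootsD4, ∑ s ∈ rootsD4, (if r = s then 0 else
      p (inner ℝ (vertex r) (vertex s)) * inner ℝ (vertex r) (w s)) =
      radialSum p * ∑ r ∈ rootsD4, inner ℝ (w r) (vertex r) := by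
    rw [Finset.sum_comm, ← h1]
    refine Finset.sum_congr rfl fun r _ => Finset.sum_congr rfl fun s _ => ?_
    rw [real_inner_comm (vertex r) (vertex s), real_inner_comm (w r) (vertex s)]
    simp only [eq_comm]
  rw [mul_assoc, two_mul, ← h1]
  nth_rewrite 2 [h1]
  rw [← h2]
  simp only [← Finset.sum_add_distrib]
  refine Finset.sum_congr rfl fun r _ => Finset.sum_congr rfl fun s _ => ?_
  split_ifs <;> ring

theorem inner_vertex_cases {r s : Fin 4 → ℤ} (hr : r ∈ rootsD4) (hs : s ∈ rootsD4) (h : r ≠ s) :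
    inner ℝ (vertex r) (vertex s) = (-1 : ℝ) ∨ inner ℝ (vertex r) (vertex s) = (-1 / 2 : ℝ) ∨
      inner ℝ (vertex r) (vertex s) = (0 : ℝ) ∨ inner ℝ (vertex r) (vertex s) = (1 / 2 : ℝ) := by
  rw [vertex_inner]
  rcases rootsD4_dotProduct_cases r hr s hs with ⟨h1, h2, -⟩ | ⟨h1, -⟩ | ⟨h1, -⟩ | ⟨h1, -⟩ | ⟨h1, -⟩
  · exact absurd h2 h
  all_goals norm_num [h1]

theorem inner_vertex_mem_Ico {r s : Fin 4 → ℤ} (hr : r ∈ rootsD4) (hs : s ∈ rootsD4)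
    (h : r ≠ s) : inner ℝ (vertex r) (vertex s) ∈ Ico (-1 : ℝ) 1 := by
  rcases inner_vertex_cases hr hs h with h | h | h | h <;> rw [h] <;> norm_num

theorem inner_mem_Ico_of_near {z : (Fin 4 → ℤ) → E4} {ρ : ℝ} (hρ : ρ ≤ 1 / 8)
    (hz : ∀ r ∈ rootsD4, ‖z r‖ = 1) (hzρ : ∀ r ∈ rootsD4, ‖z r - vertex r‖ ≤ ρ)
    {r s : Fin 4 → ℤ} (hr : r ∈ rootsD4) (hs : s ∈ rootsD4) (h : r ≠ s) :
    inner ℝ (z r) (z s) ∈ Ico (-1 : ℝ) 1 := by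
  constructor
  · have := (abs_le.1 (abs_real_inner_le_norm (z r) (z s))).1
    rwa [hz r hr, hz s hs, one_mul] at this
  · rw [inner_lt_one_iff_real_of_norm_eq_one (hz r hr) (hz s hs)]
    intro e
    have h1 : ‖vertex r - vertex s‖ ≤ 1 / 4 := by
      have := norm_sub_le (z s - vertex s) (z r - vertex r)
      rw [e, sub_sub_sub_cancel_left] at this
      have h1 := hzρ r hr
      have h2 := hzρ s hs
      rw [e] at h1
      linarith
    have h2 := norm_sub_sq_real (vertex r) (vertex s)
    rw [norm_vertex hr, norm_vertex hs] at h2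
    have h3 : inner ℝ (vertex r) (vertex s) ≤ (1 / 2 : ℝ) := by
      rcases inner_vertex_cases hr hs h with h | h | h | h <;> rw [h] <;> norm_num
    have h4 := pow_le_pow_left₀ (norm_nonneg _) h1 2
    norm_num at h4
    linarith

theorem card_rootsD4 : rootsD4.card = 24 := by decide +kernel

/-- The energy of a perturbed 24-cell, without infinitesimal rotation, exceeds the energy of the
24-cell by an amount quadratic in the perturbation. -/
theorem IsAbsMonoTower.energy_lt_of_near {F : ℕ → ℝ → ℝ} (hF : IsAbsMonoTower F) {m : ℕ}
    (hm : 5 ≤ m) (hFm : F (m + 1) (-1) ≠ 0) :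
    ∃ ρ > 0, ∀ z : (Fin 4 → ℤ) → E4, (∀ r ∈ rootsD4, ‖z r‖ = 1) →
      (∀ r ∈ rootsD4, ‖z r - vertex r‖ ≤ ρ) →
      (∀ a b, ∑ r ∈ rootsD4, z r a * vertex r b = ∑ r ∈ rootsD4, z r b * vertex r a) →
      (∃ r ∈ rootsD4, z r ≠ vertex r) →
      ∑ r ∈ rootsD4, ∑ s ∈ rootsD4, (if r = s then 0 else F 0 (inner ℝ (vertex r) (vertex s))) <
        ∑ r ∈ rootsD4, ∑ s ∈ rootsD4, (if r = s then 0 else F 0 (inner ℝ (z r) (z s))) := by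
  have hw := hermiteWeight_bounds
  have p4 : 0 < eig₄ (F 1) (F 2) :=
    hF.hermiteFunctional_pos (fun m => (hw m).1.1) (fun m h => ((hw m).2 h).1) hm hFm
  have p16 : 0 < eig₁₆ (F 1) (F 2) :=
    hF.hermiteFunctional_pos (fun m => (hw m).1.2.1) (fun m h => ((hw m).2 h).2.1) hm hFm
  have p8 : 0 < eig₈ (F 1) (F 2) :=
    hF.hermiteFunctional_pos (fun m => (hw m).1.2.2.1) (fun m h => ((hw m).2 h).2.2.1) hm hFm
  have p8' : 0 < eig₈' (F 1) (F 2) :=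
    hF.hermiteFunctional_pos (fun m => (hw m).1.2.2.2.1) (fun m h => ((hw m).2 h).2.2.2.1) hm hFm
  have p12 : 0 < eig₁₂ (F 1) (F 2) :=
    hF.hermiteFunctional_pos (fun m => (hw m).1.2.2.2.2.1) (fun m h => ((hw m).2 h).2.2.2.2.1)
      hm hFm
  have p9 : 0 < eig₉ (F 1) (F 2) :=
    hF.hermiteFunctional_pos (fun m => (hw m).1.2.2.2.2.2.1) (fun m h => ((hw m).2 h).2.2.2.2.2)
      hm hFm
  have p9' : 0 ≤ eig₉' (F 1) (F 2) :=
    hF.hermiteFunctional_nonneg fun m => (hw m).1.2.2.2.2.2.2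
  obtain ⟨ε, hε, l4, l16, l8, l8', l12, l9⟩ : ∃ ε > 0, ε ≤ eig₄ (F 1) (F 2) ∧
      ε ≤ eig₁₆ (F 1) (F 2) ∧ ε ≤ eig₈ (F 1) (F 2) ∧ ε ≤ eig₈' (F 1) (F 2) ∧
      ε ≤ eig₁₂ (F 1) (F 2) ∧ ε ≤ eig₉ (F 1) (F 2) := by
    refine ⟨_, lt_min p4 (lt_min p16 (lt_min p8 (lt_min p8' (lt_min p12 p9)))), ?_⟩
    simp
  -- a common bound for the derivatives at the inner products of the 24-cell
  obtain ⟨A, hA0, hA⟩ : ∃ A, 0 ≤ A ∧ ∀ t : ℝ, (t = -1 ∨ t = -1 / 2 ∨ t = 0 ∨ t = 1 / 2) →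
      F 1 t ≤ A ∧ F 2 t ≤ A ∧ F 3 t ≤ A := by
    have h : ∀ k, ∀ t : ℝ, (t = -1 ∨ t = -1 / 2 ∨ t = 0 ∨ t = 1 / 2) → 0 ≤ F k t :=
      fun k t ht => hF.nonneg k t (by rcases ht with rfl | rfl | rfl | rfl <;> norm_num)
    let B : ℕ → ℝ := fun k => F k (-1) + F k (-1 / 2) + F k 0 + F k (1 / 2)
    have hB : ∀ k, ∀ t : ℝ, (t = -1 ∨ t = -1 / 2 ∨ t = 0 ∨ t = 1 / 2) → F k t ≤ B k := by
      intro k t ht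
      have h1 := h k (-1) (by simp)
      have h2 := h k (-1 / 2) (by simp)
      have h3 := h k 0 (by simp)
      have h4 := h k (1 / 2) (by simp)
      rcases ht with rfl | rfl | rfl | rfl <;> simp only [B] <;> linarith
    have hB0 : ∀ k, 0 ≤ B k := fun k => (h k 0 (by simp)).trans (hB k 0 (by simp))
    refine ⟨B 1 + B 2 + B 3, by linarith [hB0 1, hB0 2, hB0 3], fun t ht => ?_⟩
    have := hB 1 t ht
    have := hB 2 t ht
    have := hB 3 t ht
    refine ⟨?_, ?_, ?_⟩ <;> linarith [hB0 1, hB0 2, hB0 3]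
  -- `433 = 2 * 24 * 9 + 1`: the pairwise errors and the quartic part of `‖v‖ ^ 2`
  have hC : 0 < 2 * (433 * A + 1) := by positivity
  refine ⟨min (1 / 8) (ε / (2 * (433 * A + 1))), by positivity, fun z hz hzρ hrot hne => ?_⟩
  set ρ := min (1 / 8) (ε / (2 * (433 * A + 1)))
  have hρ8 : ρ ≤ 1 / 8 := min_le_left _ _
  have hρ0 : 0 ≤ ρ := by positivity
  have hρε : 433 * A * ρ ≤ ε / 2 := by
    have := (le_div_iff₀ hC).1 (min_le_right (1 / 8) (ε / (2 * (433 * A + 1))))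
    change ρ * _ ≤ _ at this
    linarith
  clear_value ρ
  set v : (Fin 4 → ℤ) → E4 := fun r => tangentPart (vertex r) (z r) with hv
  have hvt : ∀ r ∈ rootsD4, inner ℝ (v r) (vertex r) = (0 : ℝ) := fun r hr =>
    inner_tangentPart (norm_vertex hr) (hz r hr)
  have hvrot : ∀ a b, ∑ r ∈ rootsD4, v r a * vertex r b = ∑ r ∈ rootsD4, v r b * vertex r a := by
    intro a b
    have := hrot a b
    rw [← sub_eq_zero, ← Finset.sum_sub_distrib] at this ⊢
    rw [← this]
    refine Finset.sum_congr rfl fun r _ => ?_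
    simp only [hv, tangentPart, PiLp.add_apply, PiLp.sub_apply, PiLp.smul_apply, smul_eq_mul]
    ring
  have hess := le_sum_hessKernel hvt hvrot l4 l16 l8 l8' l12 l9 p9' hε.le
  set N := ∑ r ∈ rootsD4, ‖z r - vertex r‖ ^ 2 with hN
  have hN0 : 0 < N := by
    obtain ⟨r, hr, h⟩ := hne
    refine Finset.sum_pos' (fun r _ => by positivity) ⟨r, hr, ?_⟩
    have := norm_pos_iff.2 (sub_ne_zero.2 h)
    positivity
  -- the quartic part of `‖v‖ ^ 2` is negligible
  set N₄ := ∑ r ∈ rootsD4, ‖z r - vertex r‖ ^ 4 with hN₄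
  have hN₄0 : 0 ≤ N₄ := Finset.sum_nonneg fun r _ => by positivity
  have hN₄N : N₄ ≤ ρ * N := by
    rw [hN₄, hN, Finset.mul_sum]
    refine Finset.sum_le_sum fun r hr => ?_
    have h1 : ‖z r - vertex r‖ ^ 2 ≤ ρ := (pow_le_of_le_one (norm_nonneg _)
      ((hzρ r hr).trans (hρ8.trans (by norm_num))) two_ne_zero).trans (hzρ r hr)
    calc ‖z r - vertex r‖ ^ 4 = ‖z r - vertex r‖ ^ 2 * ‖z r - vertex r‖ ^ 2 := by ring
      _ ≤ _ := mul_le_mul_of_nonneg_right h1 (by positivity)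
  have hvN : ∑ r ∈ rootsD4, ‖v r‖ ^ 2 = N - N₄ / 4 := by
    rw [hN, hN₄, Finset.sum_div, ← Finset.sum_sub_distrib]
    exact Finset.sum_congr rfl fun r hr => norm_tangentPart_sq (norm_vertex hr) (hz r hr)
  have hfirst := sum_offDiag_first_order (F 1) (fun r => z r - vertex r)
  have hrad : ∑ r ∈ rootsD4, (inner ℝ (z r - vertex r) (vertex r) : ℝ) = -(N / 2) := by
    rw [hN, Finset.sum_div, ← Finset.sum_neg_distrib]
    exact Finset.sum_congr rfl fun r hr =>
      inner_sub_self_of_norm_eq_one (norm_vertex hr) (hz r hr)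
  rw [hrad] at hfirst
  have hsecond := sum_offDiag_second_order (F 1) (F 2) hvt
  have herr : ∑ r ∈ rootsD4, ∑ s ∈ rootsD4,
      9 * A * ρ * (‖z r - vertex r‖ ^ 2 + ‖z s - vertex s‖ ^ 2) = 432 * A * ρ * N := by
    simp only [← Finset.mul_sum, Finset.sum_add_distrib, Finset.sum_const, card_rootsD4,
      nsmul_eq_mul, ← hN]
    push_cast
    ring
  have hpair : ∑ r ∈ rootsD4, ∑ s ∈ rootsD4,
      (if r = s then 0 else F 0 (inner ℝ (vertex r) (vertex s))) +
      ∑ r ∈ rootsD4, ∑ s ∈ rootsD4, (if r = s then 0 else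
        F 1 (inner ℝ (vertex r) (vertex s)) *
          (inner ℝ (z r - vertex r) (vertex s) + inner ℝ (vertex r) (z s - vertex s))) +
      ∑ r ∈ rootsD4, ∑ s ∈ rootsD4, (if r = s then 0 else
        F 1 (inner ℝ (vertex r) (vertex s)) * inner ℝ (v r) (v s) +
        F 2 (inner ℝ (vertex r) (vertex s)) / 2 *
          (inner ℝ (v r) (vertex s) + inner ℝ (vertex r) (v s)) ^ 2) -
      ∑ r ∈ rootsD4, ∑ s ∈ rootsD4,
        9 * A * ρ * (‖z r - vertex r‖ ^ 2 + ‖z s - vertex s‖ ^ 2) ≤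
      ∑ r ∈ rootsD4, ∑ s ∈ rootsD4, (if r = s then 0 else F 0 (inner ℝ (z r) (z s))) := by
    simp only [← Finset.sum_add_distrib, ← Finset.sum_sub_distrib]
    refine Finset.sum_le_sum fun r hr => Finset.sum_le_sum fun s hs => ?_
    by_cases h : r = s
    · simp only [if_pos h]
      have : 0 ≤ 9 * A * ρ * (‖z r - vertex r‖ ^ 2 + ‖z s - vertex s‖ ^ 2) := by positivity
      linarith
    · simp only [if_neg h]
      obtain ⟨a1, a2, a3⟩ := hA _ (inner_vertex_cases hr hs h)
      exact hF.second_order_le (norm_vertex hr) (norm_vertex hs) (hz r hr) (hz s hs)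
        (hzρ r hr) (hzρ s hs) (hρ8.trans (by norm_num)) (inner_vertex_mem_Ico hr hs h)
        (inner_mem_Ico_of_near hρ8 hz hzρ hr hs h) a1 a2 a3
  rw [hfirst, hsecond, herr, hvN] at hpair
  rw [hvN] at hess
  have hκ : radialSum (F 1) * N₄ ≤ 4 * (A * (ρ * N)) := by
    have h1 : radialSum (F 1) ≤ 4 * A := by
      have := (hA (1 / 2) (by simp)).1
      have := hF.nonneg 1 (-1) (by norm_num)
      have := hF.nonneg 1 (-1 / 2) (by norm_num)
      rw [radialSum]
      linarith
    calc radialSum (F 1) * N₄ ≤ 4 * A * N₄ := mul_le_mul_of_nonneg_right h1 hN₄0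
      _ ≤ 4 * A * (ρ * N) := mul_le_mul_of_nonneg_left hN₄N (by positivity)
      _ = _ := by ring
  have hρN : ρ * N ≤ N := mul_le_of_le_one_left hN0.le (hρ8.trans (by norm_num))
  have h5 : ε * (3 / 4 * N) ≤ ε * (N - N₄ / 4) := mul_le_mul_of_nonneg_left (by linarith) hε.le
  have h6 := mul_le_mul_of_nonneg_right hρε hN0.le
  have h7 : 0 < ε * N := mul_pos hε hN0
  linarith

/-! ### Removing the rotations -/

section PlaneRotation

variable {E : Type*} [NormedAddCommGroup E] [InnerProductSpace ℝ E]

/-- The rotation in the plane of the orthonormal vectors `u` and `w` by the angle with cosine `c`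
and sine `s`. -/
def planeRotation (u w : E) (c s : ℝ) : E →L[ℝ] E :=
  ContinuousLinearMap.id ℝ E + (innerSL ℝ u).smulRight ((c - 1) • u + s • w) +
    (innerSL ℝ w).smulRight ((c - 1) • w - s • u)

theorem planeRotation_apply (u w : E) (c s : ℝ) (x : E) :
    planeRotation u w c s x = x + (((c - 1) * inner ℝ u x - s * inner ℝ w x) • u +
      ((c - 1) * inner ℝ w x + s * inner ℝ u x) • w) := by
  simp only [planeRotation, add_apply, ContinuousLinearMap.id_apply,
    ContinuousLinearMap.smulRight_apply, innerSL_apply_apply]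
  module

theorem norm_planeRotation {u w : E} (hu : ‖u‖ = 1) (hw : ‖w‖ = 1)
    (huw : inner ℝ u w = (0 : ℝ)) {c s : ℝ} (hcs : c ^ 2 + s ^ 2 = 1) (x : E) :
    ‖planeRotation u w c s x‖ = ‖x‖ := by
  refine (sq_eq_sq₀ (norm_nonneg _) (norm_nonneg _)).1 ?_
  rw [planeRotation_apply, norm_add_sq_real, norm_add_sq_real]
  simp only [inner_add_right, real_inner_smul_left, real_inner_smul_right, norm_smul, hu, hw, huw,
    real_inner_comm x, Real.norm_eq_abs, mul_one, sq_abs]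
  rw [real_inner_comm u x, real_inner_comm w x]
  linear_combination (inner ℝ u x ^ 2 + inner ℝ w x ^ 2) * hcs

end PlaneRotation

/-- Among all isometries there is one which brings the points `x i` closest to the points `y i` in
the sense of least squares. For this one the matrix `∑ i, x i * (y i)ᵀ` is symmetric, since the
infinitesimal rotations do not improve it. -/
theorem exists_isometry_symm {ι : Type*} (S : Finset ι) (x y : ι → E4) :
    ∃ g : E4 ≃ₗᵢ[ℝ] E4,
      (∀ a b, ∑ i ∈ S, g (x i) a * y i b = ∑ i ∈ S, g (x i) b * y i a) ∧
      ∑ i ∈ S, inner ℝ (x i) (y i) ≤ ∑ i ∈ S, (inner ℝ (g (x i)) (y i) : ℝ) := by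
  let K : Set (E4 →L[ℝ] E4) := {L | ∀ x, ‖L x‖ = ‖x‖}
  have hKc : IsCompact K := by
    refine (isCompact_closedBall (0 : E4 →L[ℝ] E4) 1).of_isClosed_subset ?_ ?_
    · have : K = ⋂ x, {L : E4 →L[ℝ] E4 | ‖L x‖ = ‖x‖} := by
        ext
        simp [K]
      rw [this]
      exact isClosed_iInter fun x => isClosed_eq (by fun_prop) continuous_const
    · intro L hL
      rw [mem_closedBall_zero_iff]
      exact L.opNorm_le_bound zero_le_one fun x => by rw [hL x, one_mul]
  obtain ⟨L, hLK, hL⟩ := hKc.exists_isMaxOn ⟨ContinuousLinearMap.id ℝ E4, fun x => rfl⟩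
    (f := fun L => ∑ i ∈ S, (inner ℝ (L (x i)) (y i) : ℝ)) (by fun_prop)
  let g : E4 ≃ₗᵢ[ℝ] E4 := (LinearIsometry.mk L.toLinearMap hLK).toLinearIsometryEquiv rfl
  have hg : ∀ x, g x = L x := fun x => rfl
  refine ⟨g, fun a b => ?_, ?_⟩
  · simp only [hg]
    by_cases hab : a = b
    · rw [hab]
    set α := ∑ i ∈ S, L (x i) a * y i a + ∑ i ∈ S, L (x i) b * y i b with hα
    set β := ∑ i ∈ S, L (x i) a * y i b - ∑ i ∈ S, L (x i) b * y i a with hβ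
    have huw : inner ℝ (EuclideanSpace.single a (1 : ℝ) : E4) (EuclideanSpace.single b 1) =
        (0 : ℝ) := by
      rw [EuclideanSpace.inner_single_left]
      simp [hab]
    have key : ∀ c s : ℝ, c ^ 2 + s ^ 2 = 1 → (c - 1) * α + s * β ≤ 0 := by
      intro c s hcs
      have hmem : (planeRotation (EuclideanSpace.single a (1 : ℝ) : E4)
          (EuclideanSpace.single b 1) c s).comp L ∈ K := fun x =>
        (norm_planeRotation (by simp) (by simp) huw hcs (L x)).trans (hLK x)
      have h := hL hmem
      simp only [mem_ofPred_eq, ContinuousLinearMap.comp_apply, planeRotation_apply,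
        inner_add_left, real_inner_smul_left, EuclideanSpace.inner_single_left, map_one, one_mul,
        Finset.sum_add_distrib, add_le_iff_nonpos_right] at h
      rw [hα, hβ]
      refine (le_of_eq ?_).trans h
      simp only [← Finset.sum_add_distrib, ← Finset.sum_sub_distrib, Finset.mul_sum]
      exact Finset.sum_congr rfl fun i _ => by ring
    -- the rotation by the angle with half-angle tangent `τ`
    have key' : ∀ τ : ℝ, τ * β ≤ τ ^ 2 * α := by
      intro τ
      have hτ : 0 < 1 + τ ^ 2 := by positivity
      have h := key ((1 - τ ^ 2) / (1 + τ ^ 2)) (2 * τ / (1 + τ ^ 2)) (by field_simp; ring)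
      have e : ((1 - τ ^ 2) / (1 + τ ^ 2) - 1) * α + 2 * τ / (1 + τ ^ 2) * β =
          2 * (τ * β - τ ^ 2 * α) / (1 + τ ^ 2) := by
        field_simp
        ring
      rw [e, div_le_iff₀ hτ] at h
      linarith
    have hD : 0 < |α| + 1 := by positivity
    have h := key' (β / (|α| + 1))
    have h' : β ^ 2 * (|α| + 1 - α) ≤ 0 := by
      rw [div_mul_eq_mul_div, div_pow, div_mul_eq_mul_div, div_le_div_iff₀ hD (by positivity)] at h
      have : (|α| + 1) * (β ^ 2 * (|α| + 1 - α)) ≤ 0 := by nlinarith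
      exact nonpos_of_mul_nonpos_right this hD
    have hβ0 : β ^ 2 ≤ 0 := by nlinarith [le_abs_self α, sq_nonneg β]
    exact sub_eq_zero.1 (pow_eq_zero_iff two_ne_zero |>.1 (le_antisymm hβ0 (sq_nonneg β)))
  · simpa [hg] using hL (show ContinuousLinearMap.id ℝ E4 ∈ K from fun x => rfl)

/-! ### The 24-cell as a spherical 5-design -/

theorem rootsD4_moment_two : ∀ a b, ∑ r ∈ rootsD4, r a * r b = if a = b then 12 else 0 := by
  decide +kernel

theorem rootsD4_moment_four : ∀ a b c d, ∑ r ∈ rootsD4, r a * r b * r c * r d =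
    (if a = b ∧ c = d then 4 else 0) + (if a = c ∧ b = d then 4 else 0) +
      (if a = d ∧ b = c then 4 else 0) := by
  decide +kernel

theorem neg_mem_rootsD4 : ∀ r ∈ rootsD4, -r ∈ rootsD4 := by decide +kernel

/-- The sums of the powers up to the fifth of the inner products with the vertices do not depend
on the unit vector `x`. -/
theorem sum_inner_vertex_pow {x : E4} (hx : ‖x‖ = 1) {k : ℕ} (hk : k ≤ 5) :
    ∑ r ∈ rootsD4, (inner ℝ x (vertex r) : ℝ) ^ k = ![24, 0, 6, 0, 3, 0] (Fin.ofNat 6 k) := by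
  have hodd : ∀ k, Odd k → ∑ r ∈ rootsD4, (inner ℝ x (vertex r) : ℝ) ^ k = 0 := by
    intro k hk
    have h : ∑ r ∈ rootsD4, (inner ℝ x (vertex r) : ℝ) ^ k =
        ∑ r ∈ rootsD4, -(inner ℝ x (vertex r) : ℝ) ^ k :=
      Finset.sum_nbij' (fun r => -r) (fun r => -r) neg_mem_rootsD4 neg_mem_rootsD4
        (fun r _ => neg_neg r) (fun r _ => neg_neg r) fun r _ => by
          rw [vertex_neg, inner_neg_right, hk.neg_pow, neg_neg]
    rw [Finset.sum_neg_distrib] at h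
    linarith
  have h2 : √2 ^ 2 = (2 : ℝ) := Real.sq_sqrt (by norm_num)
  have hx' : x 0 ^ 2 + x 1 ^ 2 + x 2 ^ 2 + x 3 ^ 2 = 1 := by
    have := EuclideanSpace.real_norm_sq_eq x
    rw [hx, Fin.sum_univ_four] at this
    linarith
  interval_cases k
  · simp [card_rootsD4]
  · exact hodd 1 (by decide)
  · have h : ∑ r ∈ rootsD4, (inner ℝ x (vertex r) : ℝ) ^ 2 =
        ∑ a, ∑ b, x a / √2 * (x b / √2) * ((∑ r ∈ rootsD4, r a * r b : ℤ) : ℝ) := by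
      simp_rw [inner_vertex, sq, Finset.sum_mul_sum, Int.cast_sum, Finset.mul_sum]
      rw [Finset.sum_comm]
      refine Finset.sum_congr rfl fun a _ => ?_
      rw [Finset.sum_comm]
      refine Finset.sum_congr rfl fun b _ => Finset.sum_congr rfl fun r _ => ?_
      push_cast
      ring
    rw [h]
    simp_rw [rootsD4_moment_two]
    simp [Fin.sum_univ_four, Fin.ofNat]
    field_simp
    rw [h2]
    linarith
  · exact hodd 3 (by decide)
  · have h : ∑ r ∈ rootsD4, (inner ℝ x (vertex r) : ℝ) ^ 4 =
        ∑ a, ∑ b, ∑ c, ∑ d, x a / √2 * (x b / √2) * (x c / √2) * (x d / √2) *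
          ((∑ r ∈ rootsD4, r a * r b * r c * r d : ℤ) : ℝ) := by
      have hexp : ∀ g : Fin 4 → ℝ,
          (∑ a, g a) ^ 4 = ∑ a, ∑ b, ∑ c, ∑ d, g a * g b * g c * g d := fun g => by
        simp only [Fin.sum_univ_four]
        ring
      simp_rw [inner_vertex, hexp, Int.cast_sum, Finset.mul_sum]
      rw [Finset.sum_comm]
      refine Finset.sum_congr rfl fun a _ => ?_
      rw [Finset.sum_comm]
      refine Finset.sum_congr rfl fun b _ => ?_
      rw [Finset.sum_comm]
      refine Finset.sum_congr rfl fun c _ => ?_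
      rw [Finset.sum_comm]
      refine Finset.sum_congr rfl fun d _ => Finset.sum_congr rfl fun r _ => ?_
      push_cast
      ring
    rw [h]
    simp_rw [rootsD4_moment_four]
    have h4 : √2 ^ 4 = (4 : ℝ) := by
      rw [show √2 ^ 4 = (√2 ^ 2) ^ 2 by ring, h2]
      norm_num
    simp [Fin.sum_univ_four, Fin.ofNat]
    field_simp
    rw [h4]
    linear_combination 12 * (x 0 ^ 2 + x 1 ^ 2 + x 2 ^ 2 + x 3 ^ 2 + 1) * hx'
  · exact hodd 5 (by decide)

theorem sum_one_add_inner_vertex_pow {x y : E4} (hx : ‖x‖ = 1) (hy : ‖y‖ = 1) {k : ℕ}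
    (hk : k ≤ 5) : ∑ r ∈ rootsD4, (inner ℝ x (vertex r) + 1 : ℝ) ^ k =
      ∑ r ∈ rootsD4, (inner ℝ y (vertex r) + 1 : ℝ) ^ k := by
  simp_rw [add_pow]
  rw [Finset.sum_comm, Finset.sum_comm (s := rootsD4)]
  refine Finset.sum_congr rfl fun m hm => ?_
  have hm5 : m ≤ 5 := by
    rw [Finset.mem_range] at hm
    omega
  rw [← Finset.sum_mul, ← Finset.sum_mul, ← Finset.sum_mul, ← Finset.sum_mul,
    sum_inner_vertex_pow hx hm5, sum_inner_vertex_pow hy hm5]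

/-- The kernel `(⟪x, y⟫ + 1) ^ k` is the Gram kernel of the monomials of degree `k` in `1` and the
coordinates. -/
theorem exists_feature_pow (k : ℕ) : ∃ (κ : Type) (_ : Fintype κ) (Φ : κ → E4 → ℝ),
    ∀ x y : E4, (inner ℝ x y + 1 : ℝ) ^ k = ∑ i, Φ i x * Φ i y := by
  refine ⟨Fin k → Option (Fin 4), inferInstance,
    fun φ x => ∏ j, (φ j).elim 1 fun a => x a, fun x y => ?_⟩
  have h : (inner ℝ x y + 1 : ℝ) =
      ∑ o : Option (Fin 4), (o.elim 1 fun a => x a) * (o.elim 1 fun a => y a) := by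
    rw [Fintype.sum_option, inner_eq_sum_four, Fin.sum_univ_four]
    simp
    ring
  rw [h, Finset.sum_pow']
  simp [Finset.prod_mul_distrib]

/-- Among the sets of 24 unit vectors, the 24-cell minimizes the energy of `(1 + t) ^ k` for
`k ≤ 5`. -/
theorem sum_one_add_inner_pow_le {C : Finset E4} (hC : IsConfig24 C) {k : ℕ} (hk : k ≤ 5) :
    ∑ r ∈ rootsD4, ∑ s ∈ rootsD4, (inner ℝ (vertex r) (vertex s) + 1 : ℝ) ^ k ≤
      ∑ x ∈ C, ∑ y ∈ C, (inner ℝ x y + 1 : ℝ) ^ k := by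
  obtain ⟨κ, _, Φ, hΦ⟩ := exists_feature_pow k
  have hC1 : ∀ x ∈ C, ‖x‖ = 1 := fun x hx => mem_sphere_zero_iff_norm.1 (hC.1 hx)
  have hmem : ![1, 1, 0, 0] ∈ rootsD4 := by decide +kernel
  have hcross : ∑ x ∈ C, ∑ s ∈ rootsD4, (inner ℝ x (vertex s) + 1 : ℝ) ^ k =
      ∑ r ∈ rootsD4, ∑ s ∈ rootsD4, (inner ℝ (vertex r) (vertex s) + 1 : ℝ) ^ k := by
    rw [Finset.sum_congr rfl fun x hx =>
        sum_one_add_inner_vertex_pow (hC1 x hx) (norm_vertex hmem) hk,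
      Finset.sum_congr rfl fun r hr =>
        sum_one_add_inner_vertex_pow (norm_vertex hr) (norm_vertex hmem) hk]
    simp [hC.2, card_rootsD4]
  have e1 : ∑ x ∈ C, ∑ y ∈ C, (inner ℝ x y + 1 : ℝ) ^ k = ∑ i, (∑ x ∈ C, Φ i x) ^ 2 := by
    simp_rw [hΦ, sq, Finset.sum_mul_sum]
    simp_rw [Finset.sum_comm (s := C) (t := Finset.univ)]
  have e2 : ∑ x ∈ C, ∑ s ∈ rootsD4, (inner ℝ x (vertex s) + 1 : ℝ) ^ k =
      ∑ i, (∑ x ∈ C, Φ i x) * ∑ s ∈ rootsD4, Φ i (vertex s) := by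
    simp_rw [hΦ, Finset.sum_mul_sum]
    simp_rw [Finset.sum_comm (s := rootsD4) (t := Finset.univ),
      Finset.sum_comm (s := C) (t := Finset.univ)]
  have e3 : ∑ r ∈ rootsD4, ∑ s ∈ rootsD4, (inner ℝ (vertex r) (vertex s) + 1 : ℝ) ^ k =
      ∑ i, (∑ s ∈ rootsD4, Φ i (vertex s)) ^ 2 := by
    simp_rw [hΦ, sq, Finset.sum_mul_sum]
    simp_rw [Finset.sum_comm (s := rootsD4) (t := Finset.univ)]
  have hsq : 0 ≤ ∑ i, (∑ x ∈ C, Φ i x - ∑ s ∈ rootsD4, Φ i (vertex s)) ^ 2 :=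
    Finset.sum_nonneg fun i _ => sq_nonneg _
  have hexp : ∑ i, (∑ x ∈ C, Φ i x - ∑ s ∈ rootsD4, Φ i (vertex s)) ^ 2 =
      ∑ i, (∑ x ∈ C, Φ i x) ^ 2 - 2 * ∑ i, (∑ x ∈ C, Φ i x) * ∑ s ∈ rootsD4, Φ i (vertex s) +
        ∑ i, (∑ s ∈ rootsD4, Φ i (vertex s)) ^ 2 := by
    rw [Finset.mul_sum, ← Finset.sum_sub_distrib, ← Finset.sum_add_distrib]
    exact Finset.sum_congr rfl fun i _ => by ring
  rw [hexp, ← e1, ← e2, ← e3, hcross] at hsq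
  linarith

/-! ### Local minimality of the 24-cell -/

open scoped Classical in
theorem codeEnergy_eq_sum_sum (f : ℝ → ℝ) (C : Finset E4) :
    codeEnergy f C = ∑ x ∈ C, ∑ y ∈ C, if x = y then 0 else f (inner ℝ x y) := by
  have h : C.offDiag = (C ×ˢ C).filter fun p => p.1 ≠ p.2 := by
    ext
    simp [and_assoc]
  rw [codeEnergy, h, Finset.sum_filter, Finset.sum_product]
  simp only [ne_eq, ite_not]

open scoped Classical in
theorem codeEnergy_image (f : ℝ → ℝ) {ι : Type*} [DecidableEq ι] {S : Finset ι} {z : ι → E4}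
    (hz : InjOn z S) :
    codeEnergy f (S.image z) =
      ∑ r ∈ S, ∑ s ∈ S, if r = s then 0 else f (inner ℝ (z r) (z s)) := by
  rw [codeEnergy_eq_sum_sum, Finset.sum_image hz]
  refine Finset.sum_congr rfl fun r hr => ?_
  rw [Finset.sum_image hz]
  exact Finset.sum_congr rfl fun s hs => if_congr (hz.eq_iff hr hs) rfl rfl

theorem coe_code24Cell : (code24Cell : Set E4) = vertex '' rootsD4 := by
  classical
  exact Finset.coe_image

theorem codeEnergy_code24Cell (f : ℝ → ℝ) : codeEnergy f code24Cell =
    ∑ r ∈ rootsD4, ∑ s ∈ rootsD4, if r = s then 0 else f (inner ℝ (vertex r) (vertex s)) :=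
  codeEnergy_image f vertex_injective.injOn

theorem isConfig24_code24Cell : IsConfig24 code24Cell := by
  classical
  refine ⟨?_, (Finset.card_image_of_injective _ vertex_injective).trans card_rootsD4⟩
  rw [coe_code24Cell]
  rintro _ ⟨r, hr, rfl⟩
  exact mem_sphere_zero_iff_norm.2 (norm_vertex hr)

/-- A configuration close to the 24-cell is the image of the roots under a map close to
`vertex`. -/
theorem exists_eq_image_of_hausdorffDist_lt {C : Finset E4} (hC : IsConfig24 C) {ε : ℝ}
    (hε : ε ≤ 1 / 2) (h : Metric.hausdorffDist (C : Set E4) (code24Cell : Set E4) < ε) :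
    ∃ z : (Fin 4 → ℤ) → E4, (∀ r ∈ rootsD4, ‖z r‖ = 1) ∧
      (∀ r ∈ rootsD4, ‖z r - vertex r‖ < ε) ∧ InjOn z rootsD4 ∧
      (C : Set E4) = z '' rootsD4 := by
  classical
  have hne : (C : Set E4).Nonempty := by
    rw [Finset.coe_nonempty, ← Finset.card_pos, hC.2]
    norm_num
  have hne' : (code24Cell : Set E4).Nonempty := by
    rw [Finset.coe_nonempty, ← Finset.card_pos, isConfig24_code24Cell.2]
    norm_num
  have hfin := Metric.hausdorffEDist_ne_top_of_nonempty_of_bounded hne hne'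
    C.finite_toSet.isBounded code24Cell.finite_toSet.isBounded
  have hex : ∀ r, ∃ c, r ∈ rootsD4 → c ∈ C ∧ ‖c - vertex r‖ < ε := by
    intro r
    by_cases hr : r ∈ rootsD4
    · obtain ⟨c, hc, hcd⟩ := Metric.exists_dist_lt_of_hausdorffDist_lt'
        (coe_code24Cell ▸ mem_image_of_mem vertex hr : vertex r ∈ (code24Cell : Set E4)) h hfin
      exact ⟨c, fun _ => ⟨hc, by rwa [← dist_eq_norm]⟩⟩
    · exact ⟨0, fun hr' => absurd hr' hr⟩
  choose z hz using hex
  have hinj : InjOn z rootsD4 := by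
    intro r hr s hs e
    by_contra hrs
    have h1 : ‖vertex r - vertex s‖ < 1 := by
      have := norm_sub_le (z s - vertex s) (z r - vertex r)
      rw [e, sub_sub_sub_cancel_left] at this
      have h1 := (hz r hr).2
      have h2 := (hz s hs).2
      rw [e] at h1
      linarith
    have h2 := norm_sub_sq_real (vertex r) (vertex s)
    rw [norm_vertex hr, norm_vertex hs] at h2
    have h3 : inner ℝ (vertex r) (vertex s) ≤ (1 / 2 : ℝ) := by
      rcases inner_vertex_cases hr hs hrs with h | h | h | h <;> rw [h] <;> norm_num
    have h4 := pow_lt_pow_left₀ h1 (norm_nonneg _) two_ne_zero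
    linarith
  refine ⟨z, fun r hr => mem_sphere_zero_iff_norm.1 (hC.1 (hz r hr).1), fun r hr => (hz r hr).2,
    hinj, ?_⟩
  have hsub : rootsD4.image z ⊆ C := fun c hc => by
    obtain ⟨r, hr, rfl⟩ := Finset.mem_image.1 hc
    exact (hz r hr).1
  have hcard : C.card ≤ (rootsD4.image z).card := by
    rw [Finset.card_image_of_injOn hinj, card_rootsD4, hC.2]
  rw [← Finset.eq_of_subset_of_card_le hsub hcard, Finset.coe_image]

/-- The energy of a configuration, for a function which is polynomial on `[-1, 1)`. -/
theorem codeEnergy_eq_of_eq_sum {f : ℝ → ℝ} {a : ℕ → ℝ} {n : ℕ}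
    (hf : ∀ t ∈ Ico (-1 : ℝ) 1, f t = ∑ k ∈ Finset.range n, a k * (t + 1) ^ k)
    {C : Finset E4} (hC : IsConfig24 C) :
    codeEnergy f C = ∑ k ∈ Finset.range n, a k * ∑ x ∈ C, ∑ y ∈ C, (inner ℝ x y + 1 : ℝ) ^ k -
      24 * ∑ k ∈ Finset.range n, a k * 2 ^ k := by
  classical
  have hC1 : ∀ x ∈ C, ‖x‖ = 1 := fun x hx => mem_sphere_zero_iff_norm.1 (hC.1 hx)
  have hdiag : (24 : ℝ) * ∑ k ∈ Finset.range n, a k * 2 ^ k =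
      ∑ x ∈ C, ∑ y ∈ C, if x = y then ∑ k ∈ Finset.range n, a k * 2 ^ k else 0 := by
    generalize ∑ k ∈ Finset.range n, a k * (2 : ℝ) ^ k = G
    symm
    calc ∑ x ∈ C, ∑ y ∈ C, (if x = y then G else 0) = ∑ _x ∈ C, G :=
          Finset.sum_congr rfl fun x hx => by rw [Finset.sum_ite_eq, if_pos hx]
      _ = 24 * G := by
          rw [Finset.sum_const, hC.2, nsmul_eq_mul]
          norm_num
  have hswap : ∑ k ∈ Finset.range n, a k * ∑ x ∈ C, ∑ y ∈ C, (inner ℝ x y + 1 : ℝ) ^ k =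
      ∑ x ∈ C, ∑ y ∈ C, ∑ k ∈ Finset.range n, a k * (inner ℝ x y + 1 : ℝ) ^ k := by
    simp_rw [Finset.mul_sum]
    rw [Finset.sum_comm]
    exact Finset.sum_congr rfl fun x _ => Finset.sum_comm
  rw [codeEnergy_eq_sum_sum, hdiag, hswap]
  simp only [← Finset.sum_sub_distrib]
  refine Finset.sum_congr rfl fun x hx => Finset.sum_congr rfl fun y hy => ?_
  split_ifs with h
  · subst h
    rw [real_inner_self_eq_norm_sq, hC1 x hx]
    norm_num
  · rw [sub_zero, hf]
    refine ⟨?_, (inner_lt_one_iff_real_of_norm_eq_one (hC1 x hx) (hC1 y hy)).2 h⟩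
    have := (abs_le.1 (abs_real_inner_le_norm x y)).1
    rwa [hC1 x hx, hC1 y hy, one_mul] at this

/-- For a polynomial of degree at most five, the 24-cell is a global minimum of the energy. -/
theorem codeEnergy_code24Cell_le_of_eq_sum {f : ℝ → ℝ} {a : ℕ → ℝ} (ha : ∀ k, 0 ≤ a k)
    (hf : ∀ t ∈ Ico (-1 : ℝ) 1, f t = ∑ k ∈ Finset.range 6, a k * (t + 1) ^ k)
    {C : Finset E4} (hC : IsConfig24 C) : codeEnergy f code24Cell ≤ codeEnergy f C := by
  classical
  rw [codeEnergy_eq_of_eq_sum hf hC, codeEnergy_eq_of_eq_sum hf isConfig24_code24Cell]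
  refine sub_le_sub_right (Finset.sum_le_sum fun k hk => mul_le_mul_of_nonneg_left ?_ (ha k)) _
  refine le_trans (le_of_eq ?_)
    (sum_one_add_inner_pow_le hC (k := k) (by rw [Finset.mem_range] at hk; omega))
  change ∑ x ∈ rootsD4.image vertex, ∑ y ∈ rootsD4.image vertex, _ = _
  simp only [Finset.sum_image vertex_injective.injOn]

/-- If some derivative of order at least six does not vanish at `-1`, the 24-cell is a strict
local minimum. -/
theorem IsAbsMonoTower.isStrictLocalMin {F : ℕ → ℝ → ℝ} (hF : IsAbsMonoTower F) {m : ℕ}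
    (hm : 5 ≤ m) (hFm : F (m + 1) (-1) ≠ 0) :
    IsStrictLocalMinEnergyModO4 (F 0) code24Cell := by
  classical
  obtain ⟨ρ, hρ, H⟩ := hF.energy_lt_of_near hm hFm
  -- the least-squares distance to the 24-cell may concentrate in one vertex, and `24 ≤ 5 ^ 2`
  refine ⟨min (1 / 2) (ρ / 5), by positivity, fun C hC hd hrot => ?_⟩
  obtain ⟨z, hz, hzε, hinj, hCz⟩ := exists_eq_image_of_hausdorffDist_lt hC (min_le_left _ _) hd
  have hzρ : ∀ r ∈ rootsD4, ‖z r - vertex r‖ ≤ ρ / 5 := fun r hr =>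
    (hzε r hr).le.trans (min_le_right _ _)
  obtain ⟨g, hsymm, hg⟩ := exists_isometry_symm rootsD4 z vertex
  have hgz : ∀ r ∈ rootsD4, ‖g (z r)‖ = 1 := fun r hr => by rw [g.norm_map, hz r hr]
  have hsq : ∀ {y : (Fin 4 → ℤ) → E4}, (∀ r ∈ rootsD4, ‖y r‖ = 1) →
      ∑ r ∈ rootsD4, ‖y r - vertex r‖ ^ 2 = 48 - 2 * ∑ r ∈ rootsD4, inner ℝ (y r) (vertex r) := by
    intro y hy
    rw [Finset.sum_congr rfl fun r hr => by
      rw [norm_sub_sq_real, hy r hr, norm_vertex hr]]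
    simp only [Finset.sum_add_distrib, Finset.sum_sub_distrib, Finset.sum_const, card_rootsD4,
      ← Finset.mul_sum, nsmul_eq_mul]
    norm_num
    ring
  have hgzρ : ∀ r ∈ rootsD4, ‖g (z r) - vertex r‖ ≤ ρ := by
    intro r hr
    refine le_of_sq_le_sq ?_ hρ.le
    have h1 : ∑ r ∈ rootsD4, ‖z r - vertex r‖ ^ 2 ≤ ∑ _r ∈ rootsD4, (ρ / 5) ^ 2 :=
      Finset.sum_le_sum fun r hr => pow_le_pow_left₀ (norm_nonneg _) (hzρ r hr) 2
    rw [Finset.sum_const, card_rootsD4, nsmul_eq_mul, hsq hz] at h1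
    have h2 := hsq (y := fun r => g (z r)) hgz
    have h3 : ‖g (z r) - vertex r‖ ^ 2 ≤ ∑ r ∈ rootsD4, ‖g (z r) - vertex r‖ ^ 2 :=
      Finset.single_le_sum (f := fun r => ‖g (z r) - vertex r‖ ^ 2)
        (fun r _ => by positivity) hr
    push_cast at h1
    nlinarith [sq_nonneg ρ]
  have hCimg : C = rootsD4.image z := by
    rw [← Finset.coe_inj, hCz, Finset.coe_image]
  have hE : codeEnergy (F 0) C =
      ∑ r ∈ rootsD4, ∑ s ∈ rootsD4, if r = s then 0 else F 0 (inner ℝ (g (z r)) (g (z s))) := by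
    rw [hCimg, codeEnergy_image _ hinj]
    simp only [g.inner_map_map]
  rw [hE, codeEnergy_code24Cell]
  refine H (fun r => g (z r)) hgz hgzρ hsymm ?_
  by_contra! hcon
  refine hrot ⟨g.symm, ?_⟩
  rw [hCz, coe_code24Cell, image_image]
  refine image_congr fun r hr => ?_
  rw [← hcon r hr, g.symm_apply_apply]

theorem codeEnergy_image_isometry (f : ℝ → ℝ) (g : E4 ≃ₗᵢ[ℝ] E4) {C C₀ : Finset E4}
    (h : (C : Set E4) = g '' (C₀ : Set E4)) : codeEnergy f C = codeEnergy f C₀ := by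
  classical
  have hC : C = C₀.image g := by rw [← Finset.coe_inj, h, Finset.coe_image]
  rw [hC, codeEnergy_image f g.injective.injOn, codeEnergy_eq_sum_sum]
  simp only [g.inner_map_map]

theorem IsStrictLocalMinEnergyModO4.isLocalMinEnergy {f : ℝ → ℝ} {C₀ : Finset E4}
    (h : IsStrictLocalMinEnergyModO4 f C₀) : IsLocalMinEnergy f C₀ := by
  obtain ⟨ε, hε, H⟩ := h
  refine ⟨ε, hε, fun C hC hd => ?_⟩
  by_cases hg : ∃ g : E4 ≃ₗᵢ[ℝ] E4, (C : Set E4) = g '' (C₀ : Set E4)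
  · obtain ⟨g, hg⟩ := hg
    exact (codeEnergy_image_isometry f g hg).ge
  · exact (H C hC hd hg).le

end

theorem mainTheorem6 (f : ℝ → ℝ) (hf : AbsolutelyMonotoneOn f (Set.Ico (-1) 1)) :
    IsLocalMinEnergy f code24Cell ∧
      ((¬ ∃ p : Polynomial ℝ, p.natDegree ≤ 5 ∧ ∀ t ∈ Set.Ico (-1 : ℝ) 1, f t = p.eval t) →
        IsStrictLocalMinEnergyModO4 f code24Cell) := by
  obtain ⟨F, hF, rfl⟩ : ∃ F : ℕ → ℝ → ℝ, IsAbsMonoTower F ∧ F 0 = f :=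
    ⟨_, hf.isAbsMonoTower, iteratedDerivWithin_zero⟩
  by_cases h : ∃ m, 5 ≤ m ∧ F (m + 1) (-1) ≠ 0
  · obtain ⟨m, hm, hFm⟩ := h
    have := hF.isStrictLocalMin hm hFm
    exact ⟨this.isLocalMinEnergy, fun _ => this⟩
  · push Not at h
    have hpoly := fun t ht => hF.eq_sum_of_deriv_eq_zero h (t := t) ht
    have ha : ∀ k : ℕ, 0 ≤ F k (-1) / k.factorial := fun k =>
      div_nonneg (hF.nonneg k _ (by norm_num)) (by positivity)
    refine ⟨⟨1, one_pos, fun C hC _ => codeEnergy_code24Cell_le_of_eq_sum ha hpoly hC⟩,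
      fun hp => absurd ?_ hp⟩
    refine ⟨∑ k ∈ Finset.range 6, Polynomial.C (F k (-1) / k.factorial) * (Polynomial.X + 1) ^ k,
      Polynomial.natDegree_sum_le_of_forall_le _ _ fun k hk => ?_, fun t ht => ?_⟩
    · have hk' : k ≤ 5 := by
        rw [Finset.mem_range] at hk
        omega
      refine (Polynomial.natDegree_C_mul_le _ _).trans ?_
      refine (Polynomial.natDegree_pow_le_of_le k (m := 1) ?_).trans (by omega)
      exact (Polynomial.natDegree_X_add_C (1 : ℝ)).le
    · rw [hpoly t ht, Polynomial.eval_finsetSum]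
      simp
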